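/- **Setting.** Let $F$ be a non-abelian free group of finite rank with a fixed basis $S=\{s_1,\dots,s_n\}$ and word length $|\cdot|$. Bounded cohomology $H^\bullet_b(F)$ is taken with trivial real coefficients, computed by bounded inhomogeneous cochains $C^n_b(F)=\ell^\infty(F^n)$ with coboundary $\delta^n$; the Gromov seminorm is the quotient seminorm of $\|\cdot\|_\infty$, and $(f\smile f')(g_1,\dots,g_{n+m})=f(g_1,\dots,g_n)f'(g_{n+1},\dots,g_{n+m})$. For a quasimorphism $\varphi$, $\delta^1\varphi(g,h)=\varphi(g)+\varphi(h)-\varphi(gh)$. A product $gh$ is reduced if $|gh|=|g|+|h|$. Two words overlap if one is a proper subword of the other, or if one is $xy$ and the other $yz$ as reduced products with $x,y,z\neq1$. Let $\mathcal N$ be the set of words that do not overlap themselves. A family $I\subset F$ is independent if no two (possibly equal) words in it overlap, and symmetric if $I=I^{-1}$. Let $h_w(g)$ be the maximal number of disjoint occurrences of $w$ in $g$ minus that of $w^{-1}$. A coefficient map is a map $\alpha:F\to\mathbb R$ with $\alpha_{w^{-1}}=-\alpha_w$ that is supported on $\mathcal N$; put $\varphi_\alpha=\sum_{w\in\mathcal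 N^+}\alpha_w h_w$, where $\mathcal N^+\subset\mathcal N$ contains exactly one of $w,w^{-1}$ for each $1\ne w\in\mathcal N$ (the choice does not matter). A family $C$ of words is compatible if there is a reduced expression $u|v$ ($u,v$ finite words; if $C$ is infinite, $u$ may be left-infinite and $v$ right-infinite) such that every $w\in C$ is a reduced product $u'v'$ with $u'\ne1$ a suffix of $u$ and $v'\neq1$ a prefix of $v$. For $n\ge0$ let $\kappa_\alpha(n)=\sup_C\sum_{w\in C,\,|w|>n}|\alpha_w|$ over all compatible families $C$. Define: - $\varphi_\alpha\in Cal$ ($\varphi_\alpha$ is a Calegari quasimorphism) if $\kappa_\alpha(1)<\infty$; - $\varphi_\alpha\in\kappa(\ell^1)$ if $S\kappa_\alpha:=\sum_{n\ge0}\kappa_\alpha(n)<\infty$, and $\varphi_\alpha\in\kappa(c_0)$ if $\kappa_\alpha(n)\to0$; - $\varphi_\alpha\in\ell^1_{Ind}$ if $\alpha=\sum_{i\ge1}\alpha_i$ with $\sum_i\|\alpha_i\|_\infty<\infty$, each $\alpha_i$ being bounded, alternating and supported on a symmetric independent family $I_i$; $SInd_\alpha$ is the infimum of $\sum_i\|\alpha_i\|_\infty$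 over all such decompositions. For bounded alternating maps $\lambda=(\lambda_1,\dots,\lambda_n)$, $\lambda_i:\mathbb Z\to\mathbb R$, with $\|\lambda\|_\infty=\max_i\|\lambda_i\|_\infty$, the Rolli quasimorphism $\phi_\lambda$ sends $g=\prod_j s_{i_j}^{m_j}$ ($i_j\neq i_{j+1}$, $m_j\ne0$) to $\sum_j\lambda_{i_j}(m_j)$. **Theorem.** There is a universal constant $K$ (independent of $F$, its rank, and all the data below) such that the following holds. Let $\varphi_\alpha,\varphi_\beta\in Cal$ and let $\phi_\lambda$ be a Rolli quasimorphism. 1. If $\alpha$ and $\beta$ are supported on the same symmetric independent family $I$, then $[\delta^1\varphi_\alpha]\smile[\delta^1\varphi_\beta]=0\in H^4_b(F)$, and there is $\pi\in C^3_b(F)$ with $\delta^3\pi=\delta^1\varphi_\alpha\smile\delta^1\varphi_\beta$ and $\|\pi\|_\infty\le K\,\|\alpha\|_\infty\|\beta\|_\infty$. 2. If $\varphi_\alpha\in\ell^1_{Ind}$ and $\varphi_\beta\in\kappa(\ell^1)$, then $[\delta^1\varphi_\alpha]\smile[\delta^1\varphi_\beta]=0\in H^4_b(F)$, and there is $\pi\in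 C^3_b(F)$ with $\delta^3\pi=\delta^1\varphi_\alpha\smile\delta^1\varphi_\beta$ and $\|\pi\|_\infty\le K\,SInd_\alpha\,S\kappa_\beta$. 3. If $\varphi_\beta\in\kappa(\ell^1)$, then $[\delta^1\phi_\lambda]\smile[\delta^1\varphi_\beta]=0\in H^4_b(F)$, and there is $\pi\in C^3_b(F)$ with $\delta^3\pi=\delta^1\phi_\lambda\smile\delta^1\varphi_\beta$ and $\|\pi\|_\infty\le K\,\|\lambda\|_\infty\,S\kappa_\beta$. 4. If $\varphi_\alpha\in\ell^1_{Ind}$ and $\varphi_\beta\in\kappa(c_0)$, then $[\delta^1\varphi_\alpha]\smile[\delta^1\varphi_\beta]$ has vanishing Gromov seminorm. 5. If $\varphi_\beta\in\kappa(c_0)$, then $[\delta^1\phi_\lambda]\smile[\delta^1\varphi_\beta]$ has vanishing Gromov seminorm. -/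

import Mathlib

open scoped ENNReal NNReal Topology

universe u

noncomputable section

/-! ### Bounded cohomology of a discrete group with trivial real coefficients (bar resolution) -/

section BoundedCohomology

/-- Bounded inhomogeneous `n`-cochains `G ^ n → ℝ`, with the supremum norm. -/
abbrev BCochain (G : Type u) (n : ℕ) : Type u := lp (fun _ : Fin n → G => ℝ) ∞

/-- A bounded function as a bounded cochain. -/
def BCochain.ofBounded {G : Type u} {n : ℕ} (f : (Fin n → G) → ℝ)
    (h : ∃ C : ℝ, ∀ x, |f x| ≤ C) : BCochain G n :=
  ⟨f, memℓp_infty (by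
    obtain ⟨C, hC⟩ := h
    exact ⟨C, by rintro _ ⟨x, rfl⟩; exact hC x⟩)⟩

@[simp] theorem BCochain.ofBounded_apply {G : Type u} {n : ℕ} (f : (Fin n → G) → ℝ)
    (h : ∃ C : ℝ, ∀ x, |f x| ≤ C) (x : Fin n → G) : BCochain.ofBounded f h x = f x := rfl

theorem BCochain.abs_le {G : Type u} {n : ℕ} (f : BCochain G n) (x : Fin n → G) :
    |f x| ≤ ‖f‖ := by
  have h := lp.norm_apply_le_norm (p := ∞) (by simp) f x
  simpa [Real.norm_eq_abs] using h

theorem BCochain.ext' {G : Type u} {n : ℕ} {f g : BCochain G n} (h : ∀ x, f x = g x) : f = g :=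
  Subtype.ext (funext h)

variable {G : Type u} [Group G]

/-- The inhomogeneous coboundary of an arbitrary real function on `G ^ n`:
`f (g₂, …, gₙ₊₁) + ∑_{i = 1}^{n} (-1) ^ i f (g₁, …, gᵢ gᵢ₊₁, …, gₙ₊₁) + (-1) ^ (n + 1) f (g₁, …, gₙ)`.
The last summand is the term `j = n` of the sum, `Fin.contractNth (Fin.last n)` being the
omission of the last entry. -/
def coboundaryFun (n : ℕ) (f : (Fin n → G) → ℝ) (x : Fin (n + 1) → G) : ℝ :=
  f (fun i => x i.succ) +
    ∑ j : Fin (n + 1), (-1 : ℝ) ^ ((j : ℕ) + 1) * f (Fin.contractNth j (· * ·) x)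

theorem coboundaryFun_bounded {n : ℕ} (f : BCochain G n) :
    ∃ C : ℝ, ∀ x, |coboundaryFun n f x| ≤ C := by
  refine ⟨‖f‖ + ∑ _j : Fin (n + 1), ‖f‖, fun x => ?_⟩
  unfold coboundaryFun
  refine (abs_add_le _ _).trans (add_le_add (f.abs_le _) ?_)
  refine (Finset.abs_sum_le_sum_abs _ _).trans (Finset.sum_le_sum fun j _ => ?_)
  rw [abs_mul, abs_pow, abs_neg, abs_one, one_pow, one_mul]
  exact f.abs_le _

/-- The coboundary map `δⁿ` on bounded cochains. -/
def delta (G : Type u) [Group G] (n : ℕ) : BCochain G n →ₗ[ℝ] BCochain G (n + 1) where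
  toFun f := BCochain.ofBounded (coboundaryFun n f) (coboundaryFun_bounded f)
  map_add' f g := by
    refine BCochain.ext' fun x => ?_
    simp only [coboundaryFun, lp.coeFn_add, Pi.add_apply, mul_add, Finset.sum_add_distrib,
      BCochain.ofBounded_apply]
    ring
  map_smul' r f := by
    refine BCochain.ext' fun x => ?_
    simp only [coboundaryFun, lp.coeFn_smul, Pi.smul_apply, smul_eq_mul, RingHom.id_apply,
      mul_add, Finset.mul_sum, BCochain.ofBounded_apply]
    congr 1
    refine Finset.sum_congr rfl fun j _ => ?_
    ring

theorem delta_apply {n : ℕ} (f : BCochain G n) (x : Fin (n + 1) → G) :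
    delta G n f x = coboundaryFun n f x := rfl

/-- Bounded `n`-cocycles. -/
abbrev BCocycle (G : Type u) [Group G] (n : ℕ) : Submodule ℝ (BCochain G n) :=
  LinearMap.ker (delta G n)

/-- Coboundaries of bounded `(n - 1)`-cochains, among the bounded `n`-cochains. -/
def BCoboundary (G : Type u) [Group G] : (n : ℕ) → Submodule ℝ (BCochain G n)
  | 0 => ⊥
  | n + 1 => LinearMap.range (delta G n)

/-- Bounded cohomology `Hⁿ_b(G)`. Its norm is the quotient seminorm of the supremum norm,
i.e. the Gromov seminorm. -/
abbrev BCohomology (G : Type u) [Group G] (n : ℕ) : Type u :=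
  BCocycle G n ⧸ (BCoboundary G n).comap (BCocycle G n).subtype

/-- The class in `Hⁿ_b(G)` of a bounded cocycle. -/
def BCohomology.cls {n : ℕ} (f : BCocycle G n) : BCohomology G n := Submodule.Quotient.mk f

/-- The cup product of bounded cochains. -/
def cupCochain {G : Type u} {p q : ℕ} (f : BCochain G p) (g : BCochain G q) :
    BCochain G (p + q) :=
  BCochain.ofBounded
    (fun x => f (fun i => x (Fin.castAdd q i)) * g (fun j => x (Fin.natAdd p j)))
    ⟨‖f‖ * ‖g‖, fun x => by
      rw [abs_mul]
      exact mul_le_mul (f.abs_le _) (g.abs_le _) (abs_nonneg _) (norm_nonneg _)⟩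

theorem cupCochain_apply {G : Type u} {p q : ℕ} (f : BCochain G p) (g : BCochain G q)
    (x : Fin (p + q) → G) :
    cupCochain f g x = f (fun i => x (Fin.castAdd q i)) * g (fun j => x (Fin.natAdd p j)) := rfl

theorem coboundaryFun_one (f : (Fin 1 → G) → ℝ) (a b : G) :
    coboundaryFun 1 f ![a, b] = f ![b] - f ![a * b] + f ![a] := by
  have h0 : (fun i : Fin 1 => (![a, b] : Fin 2 → G) i.succ) = ![b] := by
    funext i; fin_cases i; rfl
  have h1 : Fin.contractNth (0 : Fin 2) (· * ·) ![a, b] = ![a * b] := by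
    funext i; fin_cases i; rfl
  have h2 : Fin.contractNth (1 : Fin 2) (· * ·) ![a, b] = ![a] := by
    funext i; fin_cases i; rfl
  change f (fun i => (![a, b] : Fin 2 → G) i.succ) + ∑ j : Fin 2, (-1 : ℝ) ^ ((j : ℕ) + 1) *
    f (Fin.contractNth (n := 1) j (· * ·) ![a, b]) = _
  simp only [Fin.sum_univ_two, h0, h1, h2, Fin.val_zero, Fin.val_one]
  ring

theorem coboundaryFun_two (f : (Fin 2 → G) → ℝ) (a b c : G) :
    coboundaryFun 2 f ![a, b, c] = f ![b, c] - f ![a * b, c] + f ![a, b * c] - f ![a, b] := by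
  have h0 : (fun i : Fin 2 => (![a, b, c] : Fin 3 → G) i.succ) = ![b, c] := by
    funext i; fin_cases i <;> rfl
  have h1 : Fin.contractNth (0 : Fin 3) (· * ·) ![a, b, c] = ![a * b, c] := by
    funext i; fin_cases i <;> rfl
  have h2 : Fin.contractNth (1 : Fin 3) (· * ·) ![a, b, c] = ![a, b * c] := by
    funext i; fin_cases i <;> rfl
  have h3 : Fin.contractNth (2 : Fin 3) (· * ·) ![a, b, c] = ![a, b] := by
    funext i; fin_cases i <;> rfl
  change f (fun i => (![a, b, c] : Fin 3 → G) i.succ) + ∑ j : Fin 3, (-1 : ℝ) ^ ((j : ℕ) + 1) *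
    f (Fin.contractNth (n := 2) j (· * ·) ![a, b, c]) = _
  simp only [Fin.sum_univ_three, h0, h1, h2, h3, Fin.val_zero, Fin.val_one,
    Fin.val_two]
  ring

theorem coboundaryFun_three (f : (Fin 3 → G) → ℝ) (a b c d : G) :
    coboundaryFun 3 f ![a, b, c, d] = f ![b, c, d] - f ![a * b, c, d] + f ![a, b * c, d]
      - f ![a, b, c * d] + f ![a, b, c] := by
  have h0 : (fun i : Fin 3 => (![a, b, c, d] : Fin 4 → G) i.succ) = ![b, c, d] := by
    funext i; fin_cases i <;> rfl
  have h1 : Fin.contractNth (0 : Fin 4) (· * ·) ![a, b, c, d] = ![a * b, c, d] := by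
    funext i; fin_cases i <;> rfl
  have h2 : Fin.contractNth (1 : Fin 4) (· * ·) ![a, b, c, d] = ![a, b * c, d] := by
    funext i; fin_cases i <;> rfl
  have h3 : Fin.contractNth (2 : Fin 4) (· * ·) ![a, b, c, d] = ![a, b, c * d] := by
    funext i; fin_cases i <;> rfl
  have h4 : Fin.contractNth (3 : Fin 4) (· * ·) ![a, b, c, d] = ![a, b, c] := by
    funext i; fin_cases i <;> rfl
  change f (fun i => (![a, b, c, d] : Fin 4 → G) i.succ) + ∑ j : Fin 4, (-1 : ℝ) ^ ((j : ℕ) + 1) *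
    f (Fin.contractNth (n := 3) j (· * ·) ![a, b, c, d]) = _
  simp only [Fin.sum_univ_four, h0, h1, h2, h3, h4, Fin.val_zero, Fin.val_one,
    Fin.val_two, show ((3 : Fin 4) : ℕ) = 3 from rfl]
  ring

theorem coboundaryFun_four (f : (Fin 4 → G) → ℝ) (a b c d e : G) :
    coboundaryFun 4 f ![a, b, c, d, e] = f ![b, c, d, e] - f ![a * b, c, d, e]
      + f ![a, b * c, d, e] - f ![a, b, c * d, e] + f ![a, b, c, d * e] - f ![a, b, c, d] := by
  have h0 : (fun i : Fin 4 => (![a, b, c, d, e] : Fin 5 → G) i.succ) = ![b, c, d, e] := by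
    funext i; fin_cases i <;> rfl
  have h1 : Fin.contractNth (0 : Fin 5) (· * ·) ![a, b, c, d, e] = ![a * b, c, d, e] := by
    funext i; fin_cases i <;> rfl
  have h2 : Fin.contractNth (1 : Fin 5) (· * ·) ![a, b, c, d, e] = ![a, b * c, d, e] := by
    funext i; fin_cases i <;> rfl
  have h3 : Fin.contractNth (2 : Fin 5) (· * ·) ![a, b, c, d, e] = ![a, b, c * d, e] := by
    funext i; fin_cases i <;> rfl
  have h4 : Fin.contractNth (3 : Fin 5) (· * ·) ![a, b, c, d, e] = ![a, b, c, d * e] := by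
    funext i; fin_cases i <;> rfl
  have h5 : Fin.contractNth (4 : Fin 5) (· * ·) ![a, b, c, d, e] = ![a, b, c, d] := by
    funext i; fin_cases i <;> rfl
  change f (fun i => (![a, b, c, d, e] : Fin 5 → G) i.succ) + ∑ j : Fin 5, (-1 : ℝ) ^ ((j : ℕ) + 1) *
    f (Fin.contractNth (n := 4) j (· * ·) ![a, b, c, d, e]) = _
  simp only [Fin.sum_univ_five, h0, h1, h2, h3, h4, h5, Fin.val_zero, Fin.val_one,
    Fin.val_two, show ((3 : Fin 5) : ℕ) = 3 from rfl, show ((4 : Fin 5) : ℕ) = 4 from rfl]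
  ring

theorem cup_two_two_apply {G : Type u} (f g : BCochain G 2) (a b c d : G) :
    cupCochain f g ![a, b, c, d] = f ![a, b] * g ![c, d] := by
  have h0 : (fun i : Fin 2 => (![a, b, c, d] : Fin 4 → G) (Fin.castAdd 2 i)) = ![a, b] := by
    funext i; fin_cases i <;> rfl
  have h1 : (fun i : Fin 2 => (![a, b, c, d] : Fin 4 → G) (Fin.natAdd 2 i)) = ![c, d] := by
    funext i; fin_cases i <;> rfl
  rw [cupCochain_apply, h0, h1]

theorem cup_one_two_apply {G : Type u} (f : BCochain G 1) (g : BCochain G 2) (a b c : G) :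
    cupCochain f g ![a, b, c] = f ![a] * g ![b, c] := by
  have h0 : (fun i : Fin 1 => (![a, b, c] : Fin 3 → G) (Fin.castAdd 2 i)) = ![a] := by
    funext i; fin_cases i; rfl
  have h1 : (fun i : Fin 2 => (![a, b, c] : Fin 3 → G) (Fin.natAdd 1 i)) = ![b, c] := by
    funext i; fin_cases i <;> rfl
  exact (cupCochain_apply f g _).trans (by rw [h0, h1])

theorem cup_two_one_apply {G : Type u} (f : BCochain G 2) (g : BCochain G 1) (a b c : G) :
    cupCochain f g ![a, b, c] = f ![a, b] * g ![c] := by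
  have h0 : (fun i : Fin 2 => (![a, b, c] : Fin 3 → G) (Fin.castAdd 1 i)) = ![a, b] := by
    funext i; fin_cases i <;> rfl
  have h1 : (fun i : Fin 1 => (![a, b, c] : Fin 3 → G) (Fin.natAdd 2 i)) = ![c] := by
    funext i; fin_cases i; rfl
  exact (cupCochain_apply f g _).trans (by rw [h0, h1])

theorem BCocycle.two_eq {f : BCochain G 2} (hf : delta G 2 f = 0) (a b c : G) :
    f ![b, c] - f ![a * b, c] + f ![a, b * c] - f ![a, b] = 0 := by
  have h := congrArg (fun k : BCochain G 3 => k ![a, b, c]) hf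
  simp only [delta_apply, coboundaryFun_two] at h
  simpa using h

theorem vec4_eta {α : Type u} (x : Fin 4 → α) : x = ![x 0, x 1, x 2, x 3] := by
  funext i; fin_cases i <;> rfl

theorem vec5_eta {α : Type u} (x : Fin 5 → α) : x = ![x 0, x 1, x 2, x 3, x 4] := by
  funext i; fin_cases i <;> rfl

theorem delta_cup_two_two {f g : BCochain G 2} (hf : delta G 2 f = 0) (hg : delta G 2 g = 0) :
    delta G 4 (cupCochain f g) = 0 := by
  refine BCochain.ext' fun x => ?_
  rw [delta_apply, vec5_eta x, coboundaryFun_four]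
  simp only [cup_two_two_apply]
  have e1 := BCocycle.two_eq hf (x 0) (x 1) (x 2)
  have e2 := BCocycle.two_eq hg (x 2) (x 3) (x 4)
  simp only [lp.coeFn_zero, Pi.zero_apply]
  linear_combination g ![x 3, x 4] * e1 + f ![x 0, x 1] * e2

theorem delta_cup_one_two (b : BCochain G 1) {g : BCochain G 2} (hg : delta G 2 g = 0) :
    delta G 3 (cupCochain b g) = cupCochain (delta G 1 b) g := by
  refine BCochain.ext' fun x => ?_
  rw [delta_apply, vec4_eta x, coboundaryFun_three, cup_two_two_apply, delta_apply,
    coboundaryFun_one]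
  simp only [cup_one_two_apply]
  have e := BCocycle.two_eq hg (x 1) (x 2) (x 3)
  linear_combination (-b ![x 0]) * e

theorem delta_cup_two_one {f : BCochain G 2} (hf : delta G 2 f = 0) (b : BCochain G 1) :
    delta G 3 (cupCochain f b) = cupCochain f (delta G 1 b) := by
  refine BCochain.ext' fun x => ?_
  rw [delta_apply, vec4_eta x, coboundaryFun_three, cup_two_two_apply, delta_apply,
    coboundaryFun_one]
  simp only [cup_two_one_apply]
  have e := BCocycle.two_eq hf (x 0) (x 1) (x 2)
  linear_combination b ![x 3] * e

/-- The cup product of two bounded `2`-cocycles, as a bounded `4`-cocycle. -/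
def cupCocycle (f g : BCocycle G 2) : BCocycle G 4 :=
  ⟨cupCochain f.1 g.1, delta_cup_two_two f.2 g.2⟩

theorem cupCocycle_congr {f f' g g' : BCocycle G 2}
    (hf : BCohomology.cls f = BCohomology.cls f') (hg : BCohomology.cls g = BCohomology.cls g') :
    BCohomology.cls (cupCocycle f g) = BCohomology.cls (cupCocycle f' g') := by
  obtain ⟨a, ha⟩ : ∃ a, delta G 1 a = f.1 - f'.1 := (Submodule.Quotient.eq _).1 hf
  obtain ⟨b, hb⟩ : ∃ b, delta G 1 b = g.1 - g'.1 := (Submodule.Quotient.eq _).1 hg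
  refine (Submodule.Quotient.eq _).2 ?_
  refine ⟨cupCochain a g.1 + cupCochain f'.1 b, ?_⟩
  rw [map_add, delta_cup_one_two a g.2, delta_cup_two_one f'.2 b, ha, hb]
  refine BCochain.ext' fun x => ?_
  change cupCochain (f.1 - f'.1) g.1 x + cupCochain f'.1 (g.1 - g'.1) x
    = cupCochain f.1 g.1 x - cupCochain f'.1 g'.1 x
  simp only [cupCochain_apply, lp.coeFn_sub, Pi.sub_apply]
  ring

/-- The cup product `H²_b(G) × H²_b(G) → H⁴_b(G)`. -/
def cup (c c' : BCohomology G 2) : BCohomology G 4 :=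
  Quotient.liftOn₂ c c' (fun f g => BCohomology.cls (cupCocycle f g)) fun _ _ _ _ h h' =>
    cupCocycle_congr (Quotient.sound h) (Quotient.sound h')

theorem cup_cls (f g : BCocycle G 2) :
    cup (BCohomology.cls f) (BCohomology.cls g) = BCohomology.cls (cupCocycle f g) := rfl

/-- `φ` is a quasimorphism: its defect is finite. -/
def IsQuasimorphism (φ : G → ℝ) : Prop := ∃ D : ℝ, ∀ g h, |φ g + φ h - φ (g * h)| ≤ D

/-- The bounded `2`-cocycle `δ¹φ(g, h) = φ(g) + φ(h) - φ(gh)` of a quasimorphism `φ`. -/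
def quasiCocycle (φ : G → ℝ) (hφ : IsQuasimorphism φ) : BCocycle G 2 :=
  ⟨BCochain.ofBounded (fun x => φ (x 0) + φ (x 1) - φ (x 0 * x 1))
    (by obtain ⟨D, hD⟩ := hφ; exact ⟨D, fun x => hD _ _⟩), by
    refine BCochain.ext' fun x => ?_
    have hx : x = ![x 0, x 1, x 2] := by funext i; fin_cases i <;> rfl
    rw [delta_apply, hx, coboundaryFun_two]
    simp [mul_assoc]
    ring⟩

/-- `[δ¹φ] ⌣ [δ¹ψ] = 0` in `H⁴_b(G)`, and `δ¹φ ⌣ δ¹ψ` has a bounded primitive of norm at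
most `B`. -/
def CupVanishesWithBound (φ ψ : G → ℝ) (B : ℝ≥0∞) : Prop :=
  ∃ (hφ : IsQuasimorphism φ) (hψ : IsQuasimorphism ψ),
    cup (BCohomology.cls (quasiCocycle φ hφ)) (BCohomology.cls (quasiCocycle ψ hψ)) = 0 ∧
    ∃ π : BCochain G 3,
      delta G 3 π = (cupCocycle (quasiCocycle φ hφ) (quasiCocycle ψ hψ) : BCochain G 4) ∧
      ‖π‖ₑ ≤ B

/-- `[δ¹φ] ⌣ [δ¹ψ]` has vanishing Gromov seminorm in `H⁴_b(G)`. -/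
def CupSeminormVanishes (φ ψ : G → ℝ) : Prop :=
  ∃ (hφ : IsQuasimorphism φ) (hψ : IsQuasimorphism ψ),
    ‖cup (BCohomology.cls (quasiCocycle φ hφ)) (BCohomology.cls (quasiCocycle ψ hψ))‖ = 0

end BoundedCohomology

/-! ### Words in a free group and Brooks quasimorphisms

`FreeGroup S` is the free group with basis `S`; `FreeGroup.norm` is the word length and
`FreeGroup.toWord` the reduced word, as a list of letters `(s, true) = s`, `(s, false) = s⁻¹`. -/

section Words

variable {S : Type u} [DecidableEq S]

/-- The product `g h` is reduced (there is no cancellation). -/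
def IsReducedMul (g h : FreeGroup S) : Prop := (g * h).norm = g.norm + h.norm

/-- `w'` is a proper subword of `w`. -/
def IsProperSubword (w' w : FreeGroup S) : Prop :=
  w' ≠ w ∧ ∃ u v, w = u * w' * v ∧ w.norm = u.norm + w'.norm + v.norm

/-- `w₁ = x y` and `w₂ = y z` as reduced products with `x, y, z` non-empty. -/
def OverlapsRight (w₁ w₂ : FreeGroup S) : Prop :=
  ∃ x y z, x ≠ 1 ∧ y ≠ 1 ∧ z ≠ 1 ∧ IsReducedMul x y ∧ IsReducedMul y z ∧
    w₁ = x * y ∧ w₂ = y * z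

/-- Two words overlap: one is a proper subword of the other, or they overlap properly. -/
def Overlap (w₁ w₂ : FreeGroup S) : Prop :=
  IsProperSubword w₁ w₂ ∨ IsProperSubword w₂ w₁ ∨ OverlapsRight w₁ w₂ ∨ OverlapsRight w₂ w₁

/-- The set of non-self-overlapping words. -/
def nonSelfOverlapping (S : Type u) [DecidableEq S] : Set (FreeGroup S) := {w | ¬ Overlap w w}

/-- No two words of `I` overlap (in particular they are all non-self-overlapping). -/
def IsIndependent (I : Set (FreeGroup S)) : Prop := ∀ w ∈ I, ∀ w' ∈ I, ¬ Overlap w w'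

/-- `I = I⁻¹`. -/
def IsSymmetricFamily (I : Set (FreeGroup S)) : Prop := ∀ w ∈ I, w⁻¹ ∈ I

/-- `P` is a possible choice of `W⁺`: a subset of `W` containing exactly one of `w`, `w⁻¹` for
every non-trivial `w ∈ W`. -/
def IsPositivePart (W P : Set (FreeGroup S)) : Prop :=
  P ⊆ W ∧ ∀ w ∈ W, w ≠ 1 → (w ∈ P ↔ w⁻¹ ∉ P)

/-- The positions at which `w` occurs as a subword of `g`. -/
def occurrences (w g : FreeGroup S) : Finset ℕ :=
  (Finset.range (g.norm + 1)).filter fun i => w.toWord <+: g.toWord.drop i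

/-- `c_w(g)`: the maximal number of disjoint occurrences of `w` as a subword of `g`. -/
def smallCount (w g : FreeGroup S) : ℕ :=
  ((occurrences w g).powerset.filter fun T => ∀ i ∈ T, ∀ j ∈ T, i < j → i + w.norm ≤ j).sup
    Finset.card

/-- The small Brooks quasimorphism `h_w = c_w - c_{w⁻¹}`. -/
def smallBrooks (w g : FreeGroup S) : ℤ := (smallCount w g : ℤ) - smallCount w⁻¹ g

/-! ### Infinite sums of Brooks quasimorphisms and Calegari quasimorphisms -/

/-- A coefficient map: alternating and supported on the non-self-overlapping words. -/
structure IsCoefficientMap (α : FreeGroup S → ℝ) : Prop where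
  alternating : ∀ w, α w⁻¹ = -α w
  support_subset : Function.support α ⊆ nonSelfOverlapping S

/-- `∑_{w ∈ P} α_w h_w`. At each `g` only finitely many terms with `w ≠ 1` are non-zero; when `α`
is a coefficient map (so `α₁ = 0`) and `P` is a positive part of the set of non-self-overlapping
words this is `φ_α`. -/
def brooksSum (P : Set (FreeGroup S)) (α : FreeGroup S → ℝ) (g : FreeGroup S) : ℝ :=
  ∑ᶠ w ∈ P, α w * (smallBrooks w g : ℝ)

/-- `w` overlaps the juncture of the reduced expression `u | v`: `u = x u'`, `v = v' y` and
`w = u' v'` as reduced products with `u', v'` non-empty. -/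
def OverlapsJuncture (u v w : FreeGroup S) : Prop :=
  ∃ x u' v' y, u = x * u' ∧ IsReducedMul x u' ∧ v = v' * y ∧ IsReducedMul v' y ∧
    w = u' * v' ∧ IsReducedMul u' v' ∧ u' ≠ 1 ∧ v' ≠ 1

/-- `b` is a reduced bi-infinite word. -/
def IsReducedBiinfinite (b : ℤ → S × Bool) : Prop :=
  ∀ i, (b i).1 = (b (i + 1)).1 → (b i).2 = (b (i + 1)).2

/-- `w = u' v'` where `u'` is a non-empty suffix of the left-infinite word `… b₋₂ b₋₁` and `v'` is
a non-empty prefix of the right-infinite word `b₀ b₁ …`. -/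
def OverlapsInfiniteJuncture (b : ℤ → S × Bool) (w : FreeGroup S) : Prop :=
  ∃ m n : ℕ, 1 ≤ m ∧ 1 ≤ n ∧
    w.toWord = List.ofFn fun k : Fin (m + n) => b ((k : ℕ) - (m : ℤ))

/-- Compatible families. For a finite family the two sides of the juncture are finite words; for
an infinite family they may be infinite (a side which is finite may be prolonged to an infinite
one, so both are taken infinite here). -/
def IsCompatible (C : Set (FreeGroup S)) : Prop :=
  (C.Finite ∧ ∃ u v : FreeGroup S, IsReducedMul u v ∧ ∀ w ∈ C, OverlapsJuncture u v w) ∨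
  (C.Infinite ∧ ∃ b : ℤ → S × Bool,
    IsReducedBiinfinite b ∧ ∀ w ∈ C, OverlapsInfiniteJuncture b w)

/-- `κ_α(n)`: the supremum over the compatible families `C` of `∑_{w ∈ C, |w| > n} |α_w|`. -/
def kappa (α : FreeGroup S → ℝ) (n : ℕ) : ℝ≥0∞ :=
  ⨆ (C : Set (FreeGroup S)) (_ : IsCompatible C), ∑' w : {w // w ∈ C ∧ n < w.norm}, ‖α w‖ₑ

/-- `φ_α ∈ Cal`. -/
structure IsCalegari (α : FreeGroup S → ℝ) : Prop extends IsCoefficientMap α where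
  kappa_one_ne_top : kappa α 1 ≠ ∞

/-- `S κ_α = ∑_{n ≥ 0} κ_α(n)`. -/
def sumKappa (α : FreeGroup S → ℝ) : ℝ≥0∞ := ∑' n, kappa α n

/-- `φ_α ∈ κ(ℓ¹)`. -/
structure IsKappaL1 (α : FreeGroup S → ℝ) : Prop extends IsCoefficientMap α where
  sumKappa_ne_top : sumKappa α ≠ ∞

/-- `φ_α ∈ κ(c₀)`. -/
structure IsKappaC0 (α : FreeGroup S → ℝ) : Prop extends IsCoefficientMap α where
  tendsto_kappa : Filter.Tendsto (kappa α) Filter.atTop (𝓝 0)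

/-- `‖α‖_∞`. -/
def supNorm (α : FreeGroup S → ℝ) : ℝ≥0∞ := ⨆ w, ‖α w‖ₑ

/-- `α = ∑ᵢ aᵢ` with `∑ᵢ ‖aᵢ‖_∞ < ∞`, each `aᵢ` being (bounded,) alternating and supported on a
symmetric independent family. -/
structure IsIndDecomposition (α : FreeGroup S → ℝ) (a : ℕ → FreeGroup S → ℝ) : Prop where
  alternating : ∀ i w, a i w⁻¹ = -a i w
  independent : ∀ i, ∃ I, IsSymmetricFamily I ∧ IsIndependent I ∧ Function.support (a i) ⊆ I
  sum_ne_top : ∑' i, supNorm (a i) ≠ ∞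
  hasSum : ∀ w, HasSum (fun i => a i w) (α w)

/-- `φ_α ∈ ℓ¹_Ind`. -/
structure IsL1Ind (α : FreeGroup S → ℝ) : Prop extends IsCoefficientMap α where
  exists_decomposition : ∃ a, IsIndDecomposition α a

/-- `SInd_α`: the infimum of `∑ᵢ ‖aᵢ‖_∞` over all decompositions `α = ∑ᵢ aᵢ` as above. -/
def sInd (α : FreeGroup S → ℝ) : ℝ≥0∞ :=
  ⨅ (a : ℕ → FreeGroup S → ℝ) (_ : IsIndDecomposition α a), ∑' i, supNorm (a i)

/-! ### Rolli quasimorphisms -/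

/-- Gathers consecutive letters with the same generator: for a reduced word this gives the
exponents in `g = s_{i₁}^{m₁} ⋯ s_{i_k}^{m_k}`, with `s_{i_j} ≠ s_{i_{j+1}}` and `m_j ≠ 0`. -/
def syllables : List (S × Bool) → List (S × ℤ)
  | [] => []
  | (s, b) :: l =>
    match syllables l with
    | [] => [(s, if b then 1 else -1)]
    | (t, m) :: r =>
      if s = t then (t, (if b then 1 else -1) + m) :: r
      else (s, if b then 1 else -1) :: (t, m) :: r

/-- A family of bounded alternating functions `λ_s : ℤ → ℝ` indexed by the basis. -/
structure IsRolliParameter (lam : S → ℤ → ℝ) : Prop where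
  alternating : ∀ s m, lam s (-m) = -lam s m
  bounded : ∀ s, ∃ C : ℝ, ∀ m, |lam s m| ≤ C

/-- `‖λ‖_∞`, the maximum of the `‖λ_s‖_∞`. -/
def rolliNorm (lam : S → ℤ → ℝ) : ℝ≥0∞ := ⨆ (s : S) (m : ℤ), ‖lam s m‖ₑ

/-- The Rolli quasimorphism `φ_λ : s_{i₁}^{m₁} ⋯ s_{i_k}^{m_k} ↦ ∑_j λ_{i_j}(m_j)`. -/
def rolli (lam : S → ℤ → ℝ) (g : FreeGroup S) : ℝ :=
  ((syllables g.toWord).map fun p => lam p.1 p.2).sum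

end Words

end

/-! ### Primitives of cup products from integration along geodesics -/

section Abstract

variable {G : Type u} [Group G]

/-! Write `ω = δ¹ψ`. The unbounded cochain `φ ⌣ ω` has coboundary `δ¹φ ⌣ ω`, so it suffices to bring
it within bounded distance of a coboundary. Suppose `φ(g)` is the total mass of a signed measure `A
g`, finitely supported on the suffixes of `g`, that is additive up to bounded error: `A (g * h) f ≈
A g (f (· * h)) + A h f`. Put `η(g, h) = A g (ω(·, h))`. The cocycle identity for `ω`, integrated
against `A g`, shows that `δ²η + φ ⌣ ω` at `(g, h, k)` is exactly the additivity error of `A` at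
`(g, h)`, tested on `ω(·, k)`. It is therefore a primitive of `δ¹φ ⌣ ω`, bounded by the additivity
error of `A` times the defect of `ψ` (`IsExtension.exists_primitive`).

For `φ_α`, the measure puts mass `α w` on each occurrence of a subword `w` in `g`, half at each of
the two suffixes that start at its endpoints (`subwordIntegral`). The total mass is `φ_α(g)`, since
non-self-overlapping words have disjoint occurrences (`brooksSum_eq_sum_subwords`). In a reduced
product only the subwords across the juncture spoil additivity, so the error is at most their total
weight, `maxJunctureMass α`; inversion symmetry reduces an arbitrary product to three reduced ones
(`isExtension_of_reduced`). Rolli quasimorphisms are treated in the same way, with syllables in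
place of subwords; there at most one syllable is cut at a juncture.

The same extensions bound the defects, so everything is controlled by products of juncture weights.
These are compared with `kappa α 1`, with `supNorm α` for independent supports, and with `sInd α` by
summing over a decomposition. The seminorm statements hold because the classes themselves are zero.
-/

/-- A functional-valued extension of `φ` that is additive along products up to an error `D`. -/
structure IsExtension (φ : G → ℝ) (A : G → (G → ℝ) →ₗ[ℝ] ℝ) (D : ℝ) : Prop where
  apply_one : ∀ g, A g (fun _ => 1) = φ g
  mul : ∀ g h f F, (∀ z, |f z| ≤ F) → |A h f - A (g * h) f + A g (fun z => f (z * h))| ≤ D * F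

variable {φ ψ : G → ℝ} {A : G → (G → ℝ) →ₗ[ℝ] ℝ} {D E : ℝ}

theorem IsExtension.defect (hA : IsExtension φ A D) (g h : G) :
    |φ g + φ h - φ (g * h)| ≤ D := by
  have := hA.mul g h (fun _ => 1) 1 (fun _ => by simp)
  simp only [hA.apply_one] at this
  rw [mul_one] at this
  convert this using 2
  ring

theorem IsExtension.isQuasimorphism (hA : IsExtension φ A D) : IsQuasimorphism φ :=
  ⟨D, hA.defect⟩

theorem quasiCocycle_apply (hψ : IsQuasimorphism ψ) (a b : G) :
    (quasiCocycle ψ hψ : BCochain G 2) ![a, b] = ψ a + ψ b - ψ (a * b) := rfl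

/-- An extension of `φ` gives a bounded primitive of `δ¹φ ⌣ δ¹ψ` for every quasimorphism `ψ`. -/
theorem IsExtension.exists_primitive (hA : IsExtension φ A D) (hφ : IsQuasimorphism φ)
    (hψ : IsQuasimorphism ψ) (hE : ∀ g h, |ψ g + ψ h - ψ (g * h)| ≤ E) :
    ∃ π : BCochain G 3,
      delta G 3 π = (cupCocycle (quasiCocycle φ hφ) (quasiCocycle ψ hψ) : BCochain G 4) ∧
      ‖π‖ ≤ D * E := by
  set ω : G → G → ℝ := fun a b => ψ a + ψ b - ψ (a * b) with hω
  -- This expression is the primitive: the additivity error of `A` at the first two entries, tested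
  -- on the bounded function `ω(·, x 2)`.
  have hbound : ∀ x : Fin 3 → G, |A (x 1) (fun z => ω z (x 2))
      - A (x 0 * x 1) (fun z => ω z (x 2)) + A (x 0) (fun z => ω (z * x 1) (x 2))| ≤ D * E :=
    fun x => hA.mul _ _ _ _ fun z => hE z _
  have hconst : ∀ g r, A g (fun _ => r) = φ g * r := fun g r => by
    have h : (fun _ => r : G → ℝ) = r • fun _ => 1 := by funext; simp
    rw [h, map_smul, hA.apply_one, smul_eq_mul, mul_comm]
  -- The cocycle identity of `ω` at `(z * b, c, d)`, integrated in `z`; its one term free of `z`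
  -- contributes the factor `φ g`.
  have hcoc : ∀ g b c d, A g (fun z => ω (z * b * c) d) - A g (fun z => ω (z * b) (c * d))
      + A g (fun z => ω (z * b) c) = φ g * ω c d := fun g b c d => by
    rw [← map_sub, ← map_add, ← hconst]
    congr 1
    funext z
    simp only [hω, Pi.add_apply, Pi.sub_apply, mul_assoc]
    ring
  refine ⟨BCochain.ofBounded _ ⟨D * E, hbound⟩, ?_, ?_⟩
  · refine BCochain.ext' fun x => ?_
    rw [delta_apply, vec4_eta x, coboundaryFun_three]
    change _ = cupCochain (quasiCocycle φ hφ : BCochain G 2) (quasiCocycle ψ hψ : BCochain G 2) _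
    rw [cup_two_two_apply, quasiCocycle_apply, quasiCocycle_apply]
    simp only [BCochain.ofBounded_apply, Matrix.cons_val_zero, Matrix.cons_val_one,
      Matrix.cons_val]
    -- One instance for each of the three functionals in the primitive; the shift by `x 1` occurs
    -- only in the third.
    have e1 := hcoc (x 1) 1 (x 2) (x 3)
    have e2 := hcoc (x 0 * x 1) 1 (x 2) (x 3)
    have e3 := hcoc (x 0) (x 1) (x 2) (x 3)
    simp only [mul_one] at e1 e2
    simp only [mul_assoc] at e1 e2 e3 ⊢
    change _ = _ * ω (x 2) (x 3)
    linear_combination e1 - e2 + e3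
  · exact lp.norm_le_of_forall_le
      ((abs_nonneg _).trans (hbound 1)) fun x => hbound x

theorem IsExtension.cupVanishesWithBound (hA : IsExtension φ A D) (hψ : IsQuasimorphism ψ)
    (hE : ∀ g h, |ψ g + ψ h - ψ (g * h)| ≤ E) {B : ℝ≥0∞} (hB : ENNReal.ofReal (D * E) ≤ B) :
    CupVanishesWithBound φ ψ B := by
  obtain ⟨π, h1, h2⟩ := hA.exists_primitive hA.isQuasimorphism hψ hE
  refine ⟨hA.isQuasimorphism, hψ, ?_, π, h1, ?_⟩
  · rw [cup_cls]
    exact (Submodule.Quotient.mk_eq_zero _).2 ⟨π, h1⟩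
  · rw [← ofReal_norm]
    exact (ENNReal.ofReal_le_ofReal h2).trans hB

theorem CupVanishesWithBound.cupSeminormVanishes {B : ℝ≥0∞} (h : CupVanishesWithBound φ ψ B) :
    CupSeminormVanishes φ ψ := by
  obtain ⟨hφ, hψ, h0, -⟩ := h
  exact ⟨hφ, hψ, by rw [h0]; exact norm_zero⟩

theorem CupVanishesWithBound.mono {B B' : ℝ≥0∞} (h : CupVanishesWithBound φ ψ B) (hB : B ≤ B') :
    CupVanishesWithBound φ ψ B' := by
  obtain ⟨hφ, hψ, h0, π, h1, h2⟩ := h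
  exact ⟨hφ, hψ, h0, π, h1, h2.trans hB⟩

end Abstract

/-! ### Reduced products in a free group -/

section Reduced

variable {S : Type u} [DecidableEq S]

/-- The reduced word of a product is always a sublist of the concatenation, so equality of lengths
forces equality of lists. -/
theorem isReducedMul_iff {g h : FreeGroup S} :
    IsReducedMul g h ↔ (g * h).toWord = g.toWord ++ h.toWord := by
  constructor
  · intro hr
    refine (FreeGroup.toWord_mul_sublist g h).eq_of_length ?_
    rw [List.length_append]
    exact hr
  · intro hr
    simp [IsReducedMul, FreeGroup.norm, hr]

theorem isReducedMul_mk {L L' : List (S × Bool)} (h : FreeGroup.IsReduced (L ++ L')) :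
    IsReducedMul (FreeGroup.mk L) (FreeGroup.mk L') := by
  have h1 : FreeGroup.IsReduced L := h.infix (List.prefix_append L L').isInfix
  have h2 : FreeGroup.IsReduced L' := h.infix (List.suffix_append L L').isInfix
  rw [isReducedMul_iff, FreeGroup.mul_mk, FreeGroup.toWord_mk, FreeGroup.toWord_mk,
    FreeGroup.toWord_mk, h.reduce_eq, h1.reduce_eq, h2.reduce_eq]

/-- Compare the last letter of the first word with the first letter of the second: either they do
not cancel and the concatenation is reduced, or both are removed and added to the cancelled part
`C`. -/
theorem exists_isReduced_append (L L' : List (S × Bool)) (hL : FreeGroup.IsReduced L)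
    (hL' : FreeGroup.IsReduced L') :
    ∃ X C Y, L = X ++ C ∧ L' = FreeGroup.invRev C ++ Y ∧ FreeGroup.IsReduced (X ++ Y) := by
  induction L using List.reverseRecOn generalizing L' with
  | nil => exact ⟨[], [], L', by simp, by simp, by simpa using hL'⟩
  | append_singleton L a ih =>
    rcases L' with - | ⟨b, L'⟩
    · exact ⟨L ++ [a], [], [], by simp, by simp, by simpa using hL⟩
    by_cases hab : a.1 = b.1 → a.2 = b.2
    · refine ⟨L ++ [a], [], b :: L', by simp, by simp, ?_⟩
      refine List.isChain_append.2 ⟨hL, hL', ?_⟩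
      simpa using hab
    · push Not at hab
      have hb : b = (a.1, !a.2) := by
        refine Prod.ext hab.1.symm ?_
        have := hab.2
        revert this
        cases a.2 <;> cases b.2 <;> simp
      obtain ⟨X, C, Y, h1, h2, h3⟩ := ih L' (hL.infix (List.prefix_append _ _).isInfix)
        (hL'.infix (List.suffix_cons _ _).isInfix)
      refine ⟨X, C ++ [a], Y, by simp [h1], ?_, h3⟩
      rw [hb, h2]
      simp [FreeGroup.invRev]

/-- Every product is reduced after a cancellation. -/
theorem exists_reduced_factorization (g h : FreeGroup S) :
    ∃ x c y, g = x * c ∧ h = c⁻¹ * y ∧ IsReducedMul x c ∧ IsReducedMul c⁻¹ y ∧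
      IsReducedMul x y := by
  obtain ⟨X, C, Y, h1, h2, h3⟩ := exists_isReduced_append g.toWord h.toWord
    FreeGroup.isReduced_toWord FreeGroup.isReduced_toWord
  refine ⟨.mk X, .mk C, .mk Y, ?_, ?_, ?_, ?_, isReducedMul_mk h3⟩
  · rw [FreeGroup.mul_mk, ← h1, FreeGroup.mk_toWord]
  · rw [FreeGroup.inv_mk, FreeGroup.mul_mk, ← h2, FreeGroup.mk_toWord]
  · exact isReducedMul_mk (h1 ▸ FreeGroup.isReduced_toWord)
  · rw [FreeGroup.inv_mk]
    exact isReducedMul_mk (h2 ▸ FreeGroup.isReduced_toWord)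

/-- With `g = x * c`, `h = c⁻¹ * y` and `g * h = x * y`, all three words are reduced products, each
of which costs one error `M`. The contributions of `x` and `y` cancel directly, those of `c` and
`c⁻¹` by the inversion rule. -/
theorem isExtension_of_reduced {φ : FreeGroup S → ℝ}
    {A : FreeGroup S → (FreeGroup S → ℝ) →ₗ[ℝ] ℝ} {M : ℝ}
    (h_one : ∀ g, A g (fun _ => 1) = φ g)
    (h_inv : ∀ g f, A g⁻¹ f = -A g (fun z => f (z * g⁻¹)))
    (h_mul : ∀ x y, IsReducedMul x y → ∀ f F, (∀ z, |f z| ≤ F) →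
      |A (x * y) f - A x (fun z => f (z * y)) - A y f| ≤ M * F) :
    IsExtension φ A (3 * M) := by
  refine ⟨h_one, fun g h f F hF => ?_⟩
  obtain ⟨x, c, y, rfl, rfl, h1, h2, h3⟩ := exists_reduced_factorization g h
  have e1 := h_mul x c h1 (fun z => f (z * (c⁻¹ * y))) F fun z => hF _
  have e2 := h_mul c⁻¹ y h2 f F hF
  have e3 := h_mul x y h3 f F hF
  rw [h_inv] at e2
  have hxy : x * c * (c⁻¹ * y) = x * y := by group
  have hz : ∀ z, z * c * (c⁻¹ * y) = z * y := fun z => by group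
  rw [hxy]
  simp only [hz] at e1
  simp only [mul_assoc] at e1 e2 e3 ⊢
  rw [abs_le] at *
  constructor <;> linarith [e1.1, e1.2, e2.1, e2.2, e3.1, e3.2]

end Reduced

/-! ### Subwords of a fixed word -/

section Subwords

variable {S : Type u} [DecidableEq S]

/-- The prefix of length `i` of a reduced word. -/
def prefixElt (g : FreeGroup S) (i : ℕ) : FreeGroup S := .mk (g.toWord.take i)

/-- The subword of `g` between the positions `i` and `j`. -/
def subwordElt (g : FreeGroup S) (i j : ℕ) : FreeGroup S := (prefixElt g i)⁻¹ * prefixElt g j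

theorem prefixElt_zero (g : FreeGroup S) : prefixElt g 0 = 1 := rfl

theorem prefixElt_norm (g : FreeGroup S) : prefixElt g g.norm = g := by
  rw [prefixElt, FreeGroup.norm, List.take_length, FreeGroup.mk_toWord]

theorem prefixElt_mul_left {x y : FreeGroup S} (h : IsReducedMul x y) {i : ℕ} (hi : i ≤ x.norm) :
    prefixElt (x * y) i = prefixElt x i := by
  rw [prefixElt, isReducedMul_iff.1 h, List.take_append_of_le_length hi, prefixElt]

theorem prefixElt_mul_right {x y : FreeGroup S} (h : IsReducedMul x y) (k : ℕ) :
    prefixElt (x * y) (x.norm + k) = x * prefixElt y k := by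
  rw [prefixElt, isReducedMul_iff.1 h, FreeGroup.norm, List.take_length_add_append,
    ← FreeGroup.mul_mk, FreeGroup.mk_toWord, prefixElt]

/-- The first `i` letters of `g⁻¹` invert the last `i` letters of `g`. Truncated subtraction makes
this correct for `i > g.norm` too. -/
theorem prefixElt_inv (g : FreeGroup S) (i : ℕ) :
    prefixElt g⁻¹ i = g⁻¹ * prefixElt g (g.norm - i) := by
  rw [eq_inv_mul_iff_mul_eq, prefixElt, FreeGroup.toWord_inv]
  have h : (FreeGroup.invRev g.toWord).take i
      = FreeGroup.invRev (g.toWord.drop (g.norm - i)) := by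
    simp [FreeGroup.invRev, FreeGroup.norm, List.take_reverse, List.map_drop]
  rw [h, ← FreeGroup.inv_mk, mul_inv_eq_iff_eq_mul, prefixElt, FreeGroup.mul_mk,
    List.take_append_drop, FreeGroup.mk_toWord]

theorem subwordElt_mul (g : FreeGroup S) (i j k : ℕ) :
    subwordElt g i j * subwordElt g j k = subwordElt g i k := by
  simp [subwordElt]

theorem toWord_subwordElt (g : FreeGroup S) {i j : ℕ} (hij : i ≤ j) :
    (subwordElt g i j).toWord = (g.toWord.drop i).take (j - i) := by
  have h : g.toWord.take j = g.toWord.take i ++ (g.toWord.drop i).take (j - i) := by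
    conv_lhs => rw [← Nat.add_sub_cancel' hij, List.take_add]
  have hr : FreeGroup.IsReduced ((g.toWord.drop i).take (j - i)) :=
    FreeGroup.isReduced_toWord.infix
      ((List.take_prefix _ _).isInfix.trans (List.drop_suffix _ _).isInfix)
  rw [subwordElt, prefixElt, prefixElt, h, ← FreeGroup.mul_mk, inv_mul_cancel_left,
    FreeGroup.toWord_mk, hr.reduce_eq]

theorem norm_subwordElt (g : FreeGroup S) {i j : ℕ} (hij : i ≤ j) (hj : j ≤ g.norm) :
    (subwordElt g i j).norm = j - i := by
  rw [FreeGroup.norm, toWord_subwordElt g hij, List.length_take, List.length_drop]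
  change j ≤ g.toWord.length at hj
  omega

theorem subwordElt_ne_one (g : FreeGroup S) {i j : ℕ} (hij : i < j) (hj : j ≤ g.norm) :
    subwordElt g i j ≠ 1 := by
  rw [Ne, ← FreeGroup.norm_eq_zero, norm_subwordElt g hij.le hj]
  omega

theorem isReducedMul_subwordElt (g : FreeGroup S) {i j k : ℕ} (hij : i ≤ j) (hjk : j ≤ k)
    (hk : k ≤ g.norm) : IsReducedMul (subwordElt g i j) (subwordElt g j k) := by
  rw [IsReducedMul, subwordElt_mul, norm_subwordElt g (hij.trans hjk) hk,
    norm_subwordElt g hij (hjk.trans hk), norm_subwordElt g hjk hk]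
  omega

theorem subwordElt_mul_left {x y : FreeGroup S} (h : IsReducedMul x y) :
    subwordElt (x * y) 0 x.norm = x := by
  rw [subwordElt, prefixElt_zero, prefixElt_mul_left h le_rfl, prefixElt_norm, inv_one, one_mul]

theorem subwordElt_mul_right {x y : FreeGroup S} (h : IsReducedMul x y) :
    subwordElt (x * y) x.norm (x * y).norm = y := by
  rw [subwordElt, prefixElt_norm, prefixElt_mul_left h le_rfl, prefixElt_norm, inv_mul_cancel_left]

theorem overlapsRight_subwordElt (g : FreeGroup S) {i j i' j' : ℕ} (h1 : i < i') (h2 : i' < j)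
    (h3 : j < j') (h4 : j' ≤ g.norm) : OverlapsRight (subwordElt g i j) (subwordElt g i' j') :=
  ⟨subwordElt g i i', subwordElt g i' j, subwordElt g j j',
    subwordElt_ne_one g h1 (by omega), subwordElt_ne_one g h2 (by omega),
    subwordElt_ne_one g h3 h4, isReducedMul_subwordElt g h1.le h2.le (by omega),
    isReducedMul_subwordElt g h2.le h3.le h4, (subwordElt_mul ..).symm, (subwordElt_mul ..).symm⟩

theorem isProperSubword_subwordElt (g : FreeGroup S) {i j i' j' : ℕ} (h1 : i ≤ i') (h2 : i' ≤ j')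
    (h3 : j' ≤ j) (h4 : j ≤ g.norm) (hne : (i, j) ≠ (i', j')) :
    IsProperSubword (subwordElt g i' j') (subwordElt g i j) := by
  rw [Ne, Prod.mk.injEq] at hne
  refine ⟨fun h => ?_, subwordElt g i i', subwordElt g j' j, ?_, ?_⟩
  · have := congrArg FreeGroup.norm h
    rw [norm_subwordElt g h2 (h3.trans h4), norm_subwordElt g (by omega) h4] at this
    omega
  · simp [subwordElt_mul]
  · rw [norm_subwordElt g h2 (h3.trans h4), norm_subwordElt g (by omega) h4,
      norm_subwordElt g h1 (by omega), norm_subwordElt g h3 h4]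
    omega

/-- Distinct subwords of `g` whose positions intersect do overlap. -/
theorem overlap_subwordElt (g : FreeGroup S) {i j i' j' : ℕ} (h1 : i' < j) (h2 : i < j')
    (hij : i < j) (hij' : i' < j') (hj : j ≤ g.norm) (hj' : j' ≤ g.norm)
    (hne : (i, j) ≠ (i', j')) : Overlap (subwordElt g i j) (subwordElt g i' j') := by
  -- Two intersecting intervals are staggered or nested according to the order of their left and
  -- right endpoints; a shared endpoint makes them nested.
  rcases lt_or_ge i i' with h | h <;> rcases lt_or_ge j j' with h' | h'
  · exact .inr (.inr (.inl (overlapsRight_subwordElt g h h1 h' hj')))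
  · exact .inr (.inl (isProperSubword_subwordElt g h.le hij'.le h' hj hne))
  · exact .inl (isProperSubword_subwordElt g h hij.le h'.le hj' hne.symm)
  · rcases h.eq_or_lt with rfl | h
    · exact .inr (.inl (isProperSubword_subwordElt g le_rfl hij'.le h' hj hne))
    rcases h'.eq_or_lt with rfl | h'
    · exact .inl (isProperSubword_subwordElt g h.le hij.le le_rfl hj' hne.symm)
    · exact .inr (.inr (.inr (overlapsRight_subwordElt g h h2 h' hj)))

theorem overlap_self_of_subwordElt_eq (g : FreeGroup S) {i j i' j' : ℕ} (h1 : i' < j) (h2 : i < j')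
    (hij : i < j) (hij' : i' < j') (hj : j ≤ g.norm) (hj' : j' ≤ g.norm)
    (hne : (i, j) ≠ (i', j')) (h : subwordElt g i j = subwordElt g i' j') :
    Overlap (subwordElt g i j) (subwordElt g i j) := by
  have := overlap_subwordElt g h1 h2 hij hij' hj hj' hne
  rwa [← h] at this

end Subwords

/-! ### Sums over the subintervals of an interval: reflection and splitting -/

section Pairs

/-- The pairs `i < j ≤ n`. -/
def increasingPairs (n : ℕ) : Finset (ℕ × ℕ) :=
  (Finset.range (n + 1) ×ˢ Finset.range (n + 1)).filter fun p => p.1 < p.2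

theorem mem_increasingPairs {n : ℕ} {p : ℕ × ℕ} :
    p ∈ increasingPairs n ↔ p.1 < p.2 ∧ p.2 ≤ n := by
  simp only [increasingPairs, Finset.mem_filter, Finset.mem_product, Finset.mem_range]
  omega

/-- Reversal of intervals, which matches the subwords of `g` with those of `g⁻¹`. -/
theorem sum_increasingPairs_reflect (n : ℕ) (F : ℕ × ℕ → ℝ) :
    ∑ p ∈ increasingPairs n, F p = ∑ p ∈ increasingPairs n, F (n - p.2, n - p.1) := by
  refine Finset.sum_nbij' (fun p => (n - p.2, n - p.1)) (fun p => (n - p.2, n - p.1)) ?_ ?_ ?_ ?_ ?_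
  all_goals
    rintro ⟨i, j⟩ h
    rw [mem_increasingPairs] at h
    dsimp only at h
  · rw [mem_increasingPairs]; dsimp only; omega
  · rw [mem_increasingPairs]; dsimp only; omega
  · ext <;> dsimp only <;> omega
  · ext <;> dsimp only <;> omega
  · dsimp only
    rw [Nat.sub_sub_self h.2, Nat.sub_sub_self (h.1.le.trans h.2)]

/-- An interval lies to the left of `m`, to the right of `m`, or has `m` in its interior. In the
last sum the shift `p.2 + 1` keeps the right endpoint strictly beyond `m`. -/
theorem sum_increasingPairs_add (m n : ℕ) (F : ℕ × ℕ → ℝ) :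
    ∑ p ∈ increasingPairs (m + n), F p = ∑ p ∈ increasingPairs m, F p
      + ∑ p ∈ increasingPairs n, F (m + p.1, m + p.2)
      + ∑ p ∈ Finset.range m ×ˢ Finset.range n, F (p.1, m + (p.2 + 1)) := by
  rw [← Finset.sum_filter_add_sum_filter_not _ (fun p => p.2 ≤ m),
    ← Finset.sum_filter_add_sum_filter_not
      (Finset.filter (fun p => ¬ p.2 ≤ m) (increasingPairs (m + n))) (fun p => m ≤ p.1),
    ← add_assoc]
  congr 1
  · congr 1
    · congr 1
      ext p
      simp only [Finset.mem_filter, mem_increasingPairs]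
      omega
    · refine Finset.sum_nbij' (fun p => (p.1 - m, p.2 - m)) (fun p => (m + p.1, m + p.2))
        ?_ ?_ ?_ ?_ ?_
      all_goals
        rintro ⟨i, j⟩ h
        simp only [Finset.mem_filter, mem_increasingPairs] at h ⊢
      · omega
      · omega
      · ext <;> dsimp only <;> omega
      · ext <;> dsimp only <;> omega
      · congr 1
        ext <;> dsimp only <;> omega
  · refine Finset.sum_nbij' (fun p => (p.1, p.2 - m - 1)) (fun p => (p.1, m + (p.2 + 1)))
      ?_ ?_ ?_ ?_ ?_
    all_goals
      rintro ⟨i, j⟩ h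
      simp only [Finset.mem_filter, mem_increasingPairs, Finset.mem_product, Finset.mem_range]
        at h ⊢
    · omega
    · omega
    · ext <;> dsimp only <;> omega
    · ext <;> dsimp only <;> omega
    · congr 1
      ext <;> dsimp only <;> omega

end Pairs

/-! ### Integration of functions against the occurrences of subwords -/

section Brooks

variable {S : Type u} [DecidableEq S] {α : FreeGroup S → ℝ}

/-- The sum over all subwords `w` of `g`, weighted by `α w`, of the average of the values of `f`
at the two suffixes of `g` cut off by the endpoints of `w`. -/
noncomputable def subwordIntegral (α : FreeGroup S → ℝ) (g : FreeGroup S) :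
    (FreeGroup S → ℝ) →ₗ[ℝ] ℝ where
  toFun f := ∑ p ∈ increasingPairs g.norm, α (subwordElt g p.1 p.2) *
    ((f ((prefixElt g p.1)⁻¹ * g) + f ((prefixElt g p.2)⁻¹ * g)) / 2)
  map_add' f f' := by
    rw [← Finset.sum_add_distrib]
    refine Finset.sum_congr rfl fun p _ => ?_
    simp only [Pi.add_apply]
    ring
  map_smul' r f := by
    rw [RingHom.id_apply, smul_eq_mul, Finset.mul_sum]
    refine Finset.sum_congr rfl fun p _ => ?_
    simp only [Pi.smul_apply, smul_eq_mul]
    ring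

theorem subwordIntegral_apply (α : FreeGroup S → ℝ) (g : FreeGroup S) (f : FreeGroup S → ℝ) :
    subwordIntegral α g f = ∑ p ∈ increasingPairs g.norm, α (subwordElt g p.1 p.2) *
      ((f ((prefixElt g p.1)⁻¹ * g) + f ((prefixElt g p.2)⁻¹ * g)) / 2) := rfl

theorem subwordIntegral_one (α : FreeGroup S → ℝ) (g : FreeGroup S) :
    subwordIntegral α g (fun _ => 1) = ∑ p ∈ increasingPairs g.norm, α (subwordElt g p.1 p.2) := by
  simp [subwordIntegral_apply]

/-- Reflection replaces each subword by its inverse, which changes the sign of its weight, and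
interchanges its two endpoints. Averaging over both endpoints makes the value of the test function
insensitive to this interchange. -/
theorem subwordIntegral_inv (hα : ∀ w, α w⁻¹ = -α w) (g : FreeGroup S) (f : FreeGroup S → ℝ) :
    subwordIntegral α g⁻¹ f = -subwordIntegral α g (fun z => f (z * g⁻¹)) := by
  rw [subwordIntegral_apply, subwordIntegral_apply, FreeGroup.norm_inv_eq,
    sum_increasingPairs_reflect, ← Finset.sum_neg_distrib]
  refine Finset.sum_congr rfl fun p hp => ?_
  rw [mem_increasingPairs] at hp
  have e1 := prefixElt_inv g (g.norm - p.1)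
  have e2 := prefixElt_inv g (g.norm - p.2)
  rw [Nat.sub_sub_self (by omega)] at e1 e2
  have e : subwordElt g⁻¹ (g.norm - p.2) (g.norm - p.1) = (subwordElt g p.1 p.2)⁻¹ := by
    simp only [subwordElt, e1, e2]
    group
  simp only [e, hα, e1, e2]
  simp only [mul_inv_rev, inv_inv, mul_assoc, mul_inv_cancel, mul_one]
  ring

/-- The total weight of the subwords of `x * y` that contain the juncture of `x` and `y`. -/
noncomputable def junctureMass (α : FreeGroup S → ℝ) (x y : FreeGroup S) : ℝ≥0∞ :=
  ∑ p ∈ Finset.range x.norm ×ˢ Finset.range y.norm,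
    ‖α (subwordElt (x * y) p.1 (x.norm + (p.2 + 1)))‖ₑ

/-- The supremum of the weights `junctureMass α x y` over the reduced products `x * y`. -/
noncomputable def maxJunctureMass (α : FreeGroup S → ℝ) : ℝ≥0∞ :=
  ⨆ (x : FreeGroup S) (y : FreeGroup S) (_ : IsReducedMul x y), junctureMass α x y

theorem maxJunctureMass_le {B : ℝ≥0∞} (h : ∀ x y, IsReducedMul x y → junctureMass α x y ≤ B) :
    maxJunctureMass α ≤ B :=
  iSup_le fun x => iSup_le fun y => iSup_le fun hxy => h x y hxy

theorem sum_abs_le_maxJunctureMass (hα : maxJunctureMass α ≠ ∞) {x y : FreeGroup S}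
    (h : IsReducedMul x y) : ∑ p ∈ Finset.range x.norm ×ˢ Finset.range y.norm,
      |α (subwordElt (x * y) p.1 (x.norm + (p.2 + 1)))| ≤ (maxJunctureMass α).toReal := by
  have hle : junctureMass α x y ≤ maxJunctureMass α :=
    le_iSup_of_le x (le_iSup_of_le y (le_iSup_of_le h le_rfl))
  refine le_of_eq_of_le ?_ (ENNReal.toReal_mono hα hle)
  rw [junctureMass, ENNReal.toReal_sum fun _ _ => by simp]
  simp

/-- A suffix of `x * y` starting inside `x` is a suffix of `x` times `y`, and one starting inside
`y` is a suffix of `y`. Hence the subwords inside either factor cancel exactly, and only those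
across the juncture remain. -/
theorem subwordIntegral_mul (hα : maxJunctureMass α ≠ ∞) {x y : FreeGroup S}
    (h : IsReducedMul x y) {f : FreeGroup S → ℝ} {F : ℝ} (hF : ∀ z, |f z| ≤ F) :
    |subwordIntegral α (x * y) f - subwordIntegral α x (fun z => f (z * y))
      - subwordIntegral α y f| ≤ (maxJunctureMass α).toReal * F := by
  have hn : (x * y).norm = x.norm + y.norm := h
  have e1 : ∀ i ≤ x.norm, (prefixElt (x * y) i)⁻¹ * (x * y) = (prefixElt x i)⁻¹ * x * y :=
    fun i hi => by rw [prefixElt_mul_left h hi, mul_assoc]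
  have e2 : ∀ k, (prefixElt (x * y) (x.norm + k))⁻¹ * (x * y) = (prefixElt y k)⁻¹ * y :=
    fun k => by rw [prefixElt_mul_right h]; group
  rw [subwordIntegral_apply α (x * y), hn, sum_increasingPairs_add,
    subwordIntegral_apply, subwordIntegral_apply]
  have s1 : ∑ p ∈ increasingPairs x.norm, α (subwordElt (x * y) p.1 p.2) *
      ((f ((prefixElt (x * y) p.1)⁻¹ * (x * y)) + f ((prefixElt (x * y) p.2)⁻¹ * (x * y))) / 2)
      = ∑ p ∈ increasingPairs x.norm, α (subwordElt x p.1 p.2) *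
      ((f ((prefixElt x p.1)⁻¹ * x * y) + f ((prefixElt x p.2)⁻¹ * x * y)) / 2) := by
    refine Finset.sum_congr rfl fun p hp => ?_
    rw [mem_increasingPairs] at hp
    rw [e1 _ hp.2, e1 _ (hp.1.le.trans hp.2), subwordElt, subwordElt,
      prefixElt_mul_left h hp.2, prefixElt_mul_left h (hp.1.le.trans hp.2)]
  have s2 : ∀ i j, subwordElt (x * y) (x.norm + i) (x.norm + j) = subwordElt y i j := fun i j => by
    rw [subwordElt, prefixElt_mul_right h, prefixElt_mul_right h, subwordElt]
    group
  simp only [s1, s2, e2]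
  rw [add_assoc, add_sub_cancel_left, add_sub_cancel_left]
  refine (Finset.abs_sum_le_sum_abs _ _).trans ?_
  have hF0 : 0 ≤ F := (abs_nonneg _).trans (hF 1)
  refine le_trans ?_ (mul_le_mul_of_nonneg_right (sum_abs_le_maxJunctureMass hα h) hF0)
  rw [Finset.sum_mul]
  refine Finset.sum_le_sum fun p _ => ?_
  rw [abs_mul]
  -- The average of two values of `f` is again bounded by `F`.
  refine mul_le_mul_of_nonneg_left ?_ (abs_nonneg _)
  have a1 := abs_le.1 (hF ((prefixElt (x * y) p.1)⁻¹ * (x * y)))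
  have a2 := abs_le.1 (hF ((prefixElt y (p.2 + 1))⁻¹ * y))
  rw [abs_le]
  constructor <;> linarith [a1.1, a1.2, a2.1, a2.2]

/-! ### Bounds for the weight at a juncture -/

/-- All these subwords contain the letters on both sides of the juncture, so one word in two
positions would overlap itself. -/
theorem injOn_juncture_subwords (hα : Function.support α ⊆ nonSelfOverlapping S)
    {x y : FreeGroup S} (h : IsReducedMul x y) :
    Set.InjOn (fun p : ℕ × ℕ => subwordElt (x * y) p.1 (x.norm + (p.2 + 1)))
      {p | p ∈ Finset.range x.norm ×ˢ Finset.range y.norm ∧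
        α (subwordElt (x * y) p.1 (x.norm + (p.2 + 1))) ≠ 0} := by
  rintro ⟨i, k⟩ ⟨hp, hne⟩ ⟨i', k'⟩ ⟨hp', -⟩ heq
  have hn : (x * y).norm = x.norm + y.norm := h
  simp only [Finset.mem_product, Finset.mem_range] at hp hp' heq hne
  by_contra hcon
  rw [Prod.mk.injEq] at hcon
  refine hα hne (overlap_self_of_subwordElt_eq _ ?_ ?_ ?_ ?_ ?_ ?_ ?_ heq)
  all_goals first | (rw [Ne, Prod.mk.injEq]; omega) | omega

theorem overlapsJuncture_subwordElt {x y : FreeGroup S} (h : IsReducedMul x y) {i j : ℕ}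
    (hi : i < x.norm) (hj : x.norm < j) (hj' : j ≤ (x * y).norm) :
    OverlapsJuncture x y (subwordElt (x * y) i j) := by
  refine ⟨subwordElt (x * y) 0 i, subwordElt (x * y) i x.norm, subwordElt (x * y) x.norm j,
    subwordElt (x * y) j (x * y).norm, ?_, isReducedMul_subwordElt _ ?_ ?_ ?_, ?_,
    isReducedMul_subwordElt _ ?_ ?_ ?_, ?_, isReducedMul_subwordElt _ ?_ ?_ ?_,
    subwordElt_ne_one _ ?_ ?_, subwordElt_ne_one _ ?_ ?_⟩
  · rw [subwordElt_mul, subwordElt_mul_left h]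
  all_goals try omega
  · rw [subwordElt_mul, subwordElt_mul_right h]
  · rw [subwordElt_mul]

/-- The words of non-zero weight across a juncture form a finite compatible family, and by
injectivity each is counted once. Each has a letter on either side, hence length at least two, which
is why `kappa` is taken at `1`. -/
theorem maxJunctureMass_le_kappa (hα : IsCoefficientMap α) :
    maxJunctureMass α ≤ kappa α 1 := by
  classical
  refine maxJunctureMass_le fun x y h => ?_
  have hn : (x * y).norm = x.norm + y.norm := h
  set W : ℕ × ℕ → FreeGroup S := fun p => subwordElt (x * y) p.1 (x.norm + (p.2 + 1)) with hW
  set R := Finset.range x.norm ×ˢ Finset.range y.norm with hR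
  set T := R.filter fun p => α (W p) ≠ 0 with hT
  have hmem : ∀ w ∈ T.image W, OverlapsJuncture x y w ∧ 1 < w.norm := by
    intro w hw
    obtain ⟨p, hp, rfl⟩ := Finset.mem_image.1 hw
    have hp' := (Finset.mem_filter.1 hp).1
    simp only [hR, Finset.mem_product, Finset.mem_range] at hp'
    refine ⟨overlapsJuncture_subwordElt h hp'.1 (by omega) (by omega), ?_⟩
    rw [hW, norm_subwordElt _ (by omega) (by omega)]
    omega
  have hsum : junctureMass α x y = ∑ w ∈ T.image W, ‖α w‖ₑ := by
    rw [Finset.sum_image]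
    · refine (Finset.sum_filter_of_ne fun p _ hp => ?_).symm
      simpa using hp
    · refine (injOn_juncture_subwords hα.support_subset h).mono fun p hp => ?_
      exact Finset.mem_filter.1 hp
  have hC : IsCompatible (↑(T.image W) : Set (FreeGroup S)) :=
    .inl ⟨Finset.finite_toSet _, x, y, h, fun w hw => (hmem w hw).1⟩
  refine le_trans ?_ (le_iSup₂_of_le _ hC le_rfl)
  rw [hsum, ← Finset.tsum_subtype]
  exact ENNReal.tsum_mono_subtype (fun w => ‖α w‖ₑ)
    (t := {w | w ∈ (↑(T.image W) : Set (FreeGroup S)) ∧ 1 < w.norm})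
    fun w hw => ⟨hw, (hmem w hw).2⟩

/-- Any two subwords across the same juncture intersect, so independence leaves at most one non-zero
term. -/
theorem junctureMass_le_supNorm {I : Set (FreeGroup S)} (hI : IsIndependent I)
    (hα : Function.support α ⊆ I) {x y : FreeGroup S} (h : IsReducedMul x y) :
    junctureMass α x y ≤ supNorm α := by
  have hn : (x * y).norm = x.norm + y.norm := h
  by_cases h0 : ∀ p ∈ Finset.range x.norm ×ˢ Finset.range y.norm,
      α (subwordElt (x * y) p.1 (x.norm + (p.2 + 1))) = 0
  · rw [junctureMass, Finset.sum_eq_zero fun p hp => by rw [h0 p hp, enorm_zero]]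
    exact zero_le
  · push Not at h0
    obtain ⟨p, hp, hne⟩ := h0
    rw [junctureMass, Finset.sum_eq_single_of_mem p hp]
    · exact le_iSup (fun w => ‖α w‖ₑ) _
    · intro q hq hqp
      rw [enorm_eq_zero]
      by_contra hne'
      rw [Finset.mem_product, Finset.mem_range, Finset.mem_range] at hp hq
      refine hI _ (hα hne) _ (hα hne') (overlap_subwordElt _ ?_ ?_ ?_ ?_ ?_ ?_ ?_)
      all_goals try omega
      rw [Ne, Prod.ext_iff] at hqp ⊢
      dsimp only
      omega

theorem maxJunctureMass_le_supNorm {I : Set (FreeGroup S)} (hI : IsIndependent I)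
    (hα : Function.support α ⊆ I) : maxJunctureMass α ≤ supNorm α :=
  maxJunctureMass_le fun _ _ => junctureMass_le_supNorm hI hα

/-- Juncture weight is countably subadditive in `α`, and each piece of a decomposition contributes
at most its supremum norm. -/
theorem maxJunctureMass_le_sInd (α : FreeGroup S → ℝ) : maxJunctureMass α ≤ sInd α := by
  refine maxJunctureMass_le fun x y h => le_iInf₂ fun a ha => ?_
  have hle : ∀ w, ‖α w‖ₑ ≤ ∑' i, ‖a i w‖ₑ := fun w => by
    rw [← (ha.hasSum w).tsum_eq]
    exact enorm_tsum_le_tsum_enorm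
  calc junctureMass α x y
      ≤ ∑ p ∈ Finset.range x.norm ×ˢ Finset.range y.norm,
          ∑' i, ‖a i (subwordElt (x * y) p.1 (x.norm + (p.2 + 1)))‖ₑ :=
        Finset.sum_le_sum fun p _ => hle _
    _ = ∑' i, junctureMass (a i) x y :=
        (Summable.tsum_finsetSum fun _ _ => ENNReal.summable).symm
    _ ≤ ∑' i, supNorm (a i) := ENNReal.tsum_le_tsum fun i => by
        obtain ⟨I, -, hI, hs⟩ := ha.independent i
        exact junctureMass_le_supNorm hI hs h

/-! ### Sums of Brooks quasimorphisms as sums over subwords -/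

theorem mem_occurrences_iff {w g : FreeGroup S} {i : ℕ} :
    i ∈ occurrences w g ↔ i + w.norm ≤ g.norm ∧ subwordElt g i (i + w.norm) = w := by
  rw [occurrences, Finset.mem_filter, Finset.mem_range, List.prefix_iff_eq_take,
    ← FreeGroup.toWord_injective.eq_iff, toWord_subwordElt g (Nat.le_add_right _ _),
    Nat.add_sub_cancel_left]
  change _ ∧ _ = List.take w.norm _ ↔ _
  constructor
  · rintro ⟨h1, h2⟩
    refine ⟨?_, h2.symm⟩
    have := congrArg List.length h2
    rw [List.length_take, List.length_drop] at this
    simp only [FreeGroup.norm] at *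
    omega
  · rintro ⟨h1, h2⟩
    exact ⟨by omega, h2.symm⟩

/-- Occurrences of a word that does not overlap itself are pairwise disjoint, so the set of all of
them is already admissible. -/
theorem smallCount_eq_card {w : FreeGroup S} (hw : w ∈ nonSelfOverlapping S)
    (g : FreeGroup S) : smallCount w g = (occurrences w g).card := by
  refine le_antisymm (Finset.sup_le fun T hT => ?_) (Finset.le_sup (f := Finset.card) ?_)
  · exact Finset.card_le_card (Finset.mem_powerset.1 (Finset.mem_filter.1 hT).1)
  · rw [Finset.mem_filter, Finset.mem_powerset]
    refine ⟨subset_rfl, fun i hi j hj hij => ?_⟩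
    by_contra hlt
    rw [mem_occurrences_iff] at hi hj
    refine hw ?_
    have := overlap_subwordElt g (i := i) (j := i + w.norm) (i' := j) (j' := j + w.norm)
      (by omega) (by omega) (by omega) (by omega) hi.1 hj.1 (by rw [Ne, Prod.mk.injEq]; omega)
    rwa [hi.2, hj.2] at this

theorem card_occurrences {w : FreeGroup S} (hw : w ≠ 1) (g : FreeGroup S) :
    (occurrences w g).card
      = ((increasingPairs g.norm).filter fun p => subwordElt g p.1 p.2 = w).card := by
  have hpos : 0 < w.norm := Nat.pos_of_ne_zero (FreeGroup.norm_eq_zero.not.2 hw)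
  refine Finset.card_nbij' (fun i => (i, i + w.norm)) Prod.fst ?_ ?_ ?_ ?_
  · intro i hi
    simp only [Finset.mem_coe, mem_occurrences_iff, Finset.mem_filter, mem_increasingPairs] at *
    exact ⟨⟨by omega, hi.1⟩, hi.2⟩
  · rintro ⟨i, j⟩ hp
    simp only [Finset.mem_coe, mem_occurrences_iff, Finset.mem_filter, mem_increasingPairs] at *
    have hn : w.norm = j - i := by rw [← hp.2, norm_subwordElt g hp.1.1.le hp.1.2]
    have hj : i + w.norm = j := by omega
    rw [hj]
    exact ⟨hp.1.2, hp.2⟩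
  · intro i _
    rfl
  · rintro ⟨i, j⟩ hp
    simp only [Finset.mem_coe, Finset.mem_filter, mem_increasingPairs] at hp
    have hn : w.norm = j - i := by rw [← hp.2, norm_subwordElt g hp.1.1.le hp.1.2]
    ext <;> dsimp only
    omega

/-- Since `α` is alternating, `α w * (c w - c w⁻¹) = α w * c w + α w⁻¹ * c w⁻¹`. Summing over one
word of each inverse pair thus sums `α w * c w` over all words, that is, `α` over all subwords of
`g`. -/
theorem brooksSum_eq_sum_subwords {P : Set (FreeGroup S)}
    (hP : IsPositivePart (nonSelfOverlapping S) P) (hα : IsCoefficientMap α) (g : FreeGroup S) :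
    brooksSum P α g = ∑ p ∈ increasingPairs g.norm, α (subwordElt g p.1 p.2) := by
  classical
  set c : FreeGroup S → ℕ := fun w =>
    ((increasingPairs g.norm).filter fun p => subwordElt g p.1 p.2 = w).card with hc
  set U := (increasingPairs g.norm).image fun p => subwordElt g p.1 p.2 with hU
  -- Inverses are included because `h_w(g)` can be non-zero when only `w⁻¹` occurs in `g`.
  set T := (U ∪ U.image (·⁻¹)).filter fun w => α w ≠ 0 with hT
  have hα1 : α 1 = 0 := by
    have := hα.alternating 1
    rw [inv_one] at this
    linarith
  have hinv : ∀ w, α w ≠ 0 → α w⁻¹ ≠ 0 := fun w hw => by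
    rw [hα.alternating]
    exact neg_ne_zero.2 hw
  have hne : ∀ w, α w ≠ 0 → w ≠ 1 := fun w hw h => hw (h ▸ hα1)
  have hTinv : ∀ w ∈ T, w⁻¹ ∈ T := fun w hw => by
    simp only [hT, Finset.mem_filter, Finset.mem_union, Finset.mem_image] at hw ⊢
    refine ⟨?_, hinv w hw.2⟩
    rcases hw.1 with h | ⟨v, hv, rfl⟩
    · exact .inr ⟨w, h, rfl⟩
    · exact .inl (by simpa using hv)
  have hcount : ∀ w, α w ≠ 0 → smallCount w g = c w := fun w hw => by
    rw [smallCount_eq_card (hα.support_subset hw), card_occurrences (hne w hw)]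
  have hcU : ∀ w, c w ≠ 0 → w ∈ U := fun w hw => by
    obtain ⟨p, hp⟩ := Finset.card_pos.1 (Nat.pos_of_ne_zero hw)
    rw [Finset.mem_filter] at hp
    exact Finset.mem_image.2 ⟨p, hp⟩
  have hright : ∑ p ∈ increasingPairs g.norm, α (subwordElt g p.1 p.2)
      = ∑ w ∈ T, α w * c w := by
    have h1 : ∑ p ∈ increasingPairs g.norm, α (subwordElt g p.1 p.2) = ∑ w ∈ U, α w * c w := by
      rw [Finset.sum_comp α fun p : ℕ × ℕ => subwordElt g p.1 p.2]
      refine Finset.sum_congr rfl fun w _ => ?_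
      rw [nsmul_eq_mul, mul_comm]
    have h2 : ∑ w ∈ U, α w * c w = ∑ w ∈ U ∪ U.image (·⁻¹), α w * c w := by
      refine Finset.sum_subset Finset.subset_union_left fun w _ hw => ?_
      have : c w = 0 := by
        by_contra h
        exact hw (hcU w h)
      rw [this, Nat.cast_zero, mul_zero]
    rw [h1, h2]
    refine (Finset.sum_filter_of_ne fun w _ hw => ?_).symm
    exact left_ne_zero_of_mul hw
  have hleft : brooksSum P α g = ∑ w ∈ T.filter (· ∈ P), α w * (c w - c w⁻¹ : ℝ) := by
    have h1 : ∀ w ∈ T, α w * (c w - c w⁻¹ : ℝ) = α w * (smallBrooks w g : ℝ) := fun w hw => by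
      have hw' := (Finset.mem_filter.1 hw).2
      rw [smallBrooks, hcount w hw', hcount _ (hinv w hw')]
      push_cast
      ring
    rw [brooksSum, finsum_mem_eq_sum_of_inter_support_eq (t := T.filter (· ∈ P))]
    · exact (Finset.sum_congr rfl fun w hw => h1 w (Finset.mem_filter.1 hw).1).symm
    · ext w
      simp only [Set.mem_inter_iff, Function.mem_support, Finset.coe_filter, Set.mem_ofPred_eq]
      refine ⟨fun ⟨h, h'⟩ => ⟨⟨?_, h⟩, h'⟩, fun ⟨h, h'⟩ => ⟨h.2, h'⟩⟩
      have hw := left_ne_zero_of_mul h'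
      have hb := right_ne_zero_of_mul h'
      rw [smallBrooks, hcount w hw, hcount _ (hinv w hw)] at hb
      rw [hT, Finset.mem_filter, Finset.mem_union]
      refine ⟨?_, hw⟩
      by_cases hz : c w = 0
      · refine .inr (Finset.mem_image.2 ⟨w⁻¹, hcU _ fun hz' => hb ?_, inv_inv w⟩)
        rw [hz, hz']
        simp
      · exact .inl (hcU w hz)
  rw [hright, hleft, ← Finset.sum_filter_add_sum_filter_not T (· ∈ P)]
  -- Inversion carries the words of `T` outside `P` bijectively onto those inside; this uses that
  -- `P` contains exactly one of each pair.
  have hflip : ∑ w ∈ T.filter (¬ · ∈ P), α w * c w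
      = ∑ w ∈ T.filter (· ∈ P), α w⁻¹ * c w⁻¹ := by
    have hmem : ∀ w ∈ T, w ∈ P ↔ w⁻¹ ∉ P := fun w hw => by
      have hw' := (Finset.mem_filter.1 hw).2
      exact hP.2 w (hα.support_subset hw') (hne w hw')
    refine Finset.sum_nbij' (·⁻¹) (·⁻¹) ?_ ?_ ?_ ?_ ?_
    · intro w hw
      rw [Finset.mem_filter] at hw ⊢
      exact ⟨hTinv w hw.1, by have := hmem w hw.1; tauto⟩
    · intro w hw
      rw [Finset.mem_filter] at hw ⊢
      exact ⟨hTinv w hw.1, (hmem w hw.1).1 hw.2⟩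
    · simp
    · simp
    · simp
  rw [hflip, ← Finset.sum_add_distrib]
  refine Finset.sum_congr rfl fun w _ => ?_
  rw [hα.alternating]
  ring

theorem isExtension_brooksSum {P : Set (FreeGroup S)}
    (hP : IsPositivePart (nonSelfOverlapping S) P) (hα : IsCoefficientMap α)
    (hM : maxJunctureMass α ≠ ∞) :
    IsExtension (brooksSum P α) (subwordIntegral α) (3 * (maxJunctureMass α).toReal) :=
  isExtension_of_reduced
    (fun g => by rw [subwordIntegral_one, brooksSum_eq_sum_subwords hP hα])
    (subwordIntegral_inv hα.alternating) fun _ _ h _ _ hF => subwordIntegral_mul hM h hF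

end Brooks

/-! ### Integration along syllables -/

section Rolli

variable {S : Type u} {lam : S → ℤ → ℝ}

/-- The group element spelled by a list of syllables. -/
def syllableProd (r : List (S × ℤ)) : FreeGroup S :=
  (r.map fun p => FreeGroup.of p.1 ^ p.2).prod

@[simp] theorem syllableProd_nil : syllableProd ([] : List (S × ℤ)) = 1 := rfl

@[simp] theorem syllableProd_cons (p : S × ℤ) (r : List (S × ℤ)) :
    syllableProd (p :: r) = FreeGroup.of p.1 ^ p.2 * syllableProd r := rfl

@[simp] theorem syllableProd_append (r r' : List (S × ℤ)) :
    syllableProd (r ++ r') = syllableProd r * syllableProd r' := by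
  simp [syllableProd]

theorem mk_cons_eq_zpow_mul (s : S) (b : Bool) (L : List (S × Bool)) :
    FreeGroup.mk ((s, b) :: L) = FreeGroup.of s ^ (if b then 1 else -1 : ℤ) * FreeGroup.mk L := by
  rw [← List.singleton_append, ← FreeGroup.mul_mk]
  cases b
  · simp [FreeGroup.of, FreeGroup.inv_mk, FreeGroup.invRev]
  · simp [FreeGroup.of]

/-- The syllables of the inverse. -/
def syllableInv (r : List (S × ℤ)) : List (S × ℤ) := (r.map fun p => (p.1, -p.2)).reverse

theorem syllableInv_cons (p : S × ℤ) (r : List (S × ℤ)) :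
    syllableInv (p :: r) = syllableInv r ++ [(p.1, -p.2)] := by
  simp [syllableInv]

/-- The sum over a list of syllables, weighted by `lam`, of the average of the values of `f` at the
elements spelled by the two tails cut off by the endpoints of the syllable. -/
noncomputable def syllableIntegral (lam : S → ℤ → ℝ) :
    List (S × ℤ) → (FreeGroup S → ℝ) →ₗ[ℝ] ℝ
  | [] => 0
  | p :: r => (lam p.1 p.2 / 2) • (LinearMap.proj (R := ℝ) (φ := fun _ => ℝ)
      (syllableProd (p :: r)) + LinearMap.proj (syllableProd r)) + syllableIntegral lam r

theorem syllableIntegral_cons (p : S × ℤ) (r : List (S × ℤ)) (f : FreeGroup S → ℝ) :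
    syllableIntegral lam (p :: r) f = lam p.1 p.2 / 2 *
      (f (FreeGroup.of p.1 ^ p.2 * syllableProd r) + f (syllableProd r))
      + syllableIntegral lam r f := rfl

@[simp] theorem syllableIntegral_nil (f : FreeGroup S → ℝ) :
    syllableIntegral lam [] f = 0 := rfl

theorem syllableIntegral_append (r r' : List (S × ℤ)) (f : FreeGroup S → ℝ) :
    syllableIntegral lam (r ++ r') f = syllableIntegral lam r (fun z => f (z * syllableProd r'))
      + syllableIntegral lam r' f := by
  induction r with
  | nil => simp
  | cons p r ih =>
    rw [List.cons_append, syllableIntegral_cons, ih, syllableIntegral_cons, syllableProd_append]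
    simp only [mul_assoc]
    ring

/-- As for subwords: the weight changes sign, and the average absorbs the exchange of the endpoints
of a syllable. -/
theorem syllableIntegral_syllableInv (hlam : ∀ s m, lam s (-m) = -lam s m) (r : List (S × ℤ))
    (f : FreeGroup S → ℝ) : syllableIntegral lam (syllableInv r) f
      = -syllableIntegral lam r (fun z => f (z * (syllableProd r)⁻¹)) := by
  induction r generalizing f with
  | nil => simp [syllableInv]
  | cons p r ih =>
    rw [syllableInv_cons, syllableIntegral_append, ih]
    simp only [syllableIntegral_cons, syllableIntegral_nil, syllableProd_cons, syllableProd_nil,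
      hlam, mul_inv_rev, mul_one, mul_assoc, zpow_neg, mul_inv_cancel, mul_inv_cancel_left]
    ring

theorem syllableIntegral_one (r : List (S × ℤ)) :
    syllableIntegral lam r (fun _ => 1) = (r.map fun p => lam p.1 p.2).sum := by
  induction r with
  | nil => simp
  | cons p r ih =>
    rw [syllableIntegral_cons, ih, List.map_cons, List.sum_cons]
    ring

/-- `x` is the concatenation of the lists of syllables `r` and `r'`, where the last syllable of `r`
and the first one of `r'` are merged if they have the same generator. -/
def IsSyllableJoin (r r' x : List (S × ℤ)) : Prop :=
  (x = r ++ r' ∧ ∀ s ∈ (r.map Prod.fst).getLast?, s ∉ (r'.map Prod.fst).head?) ∨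
  ∃ r₀ s m m' r₀', r = r₀ ++ [(s, m)] ∧ r' = (s, m') :: r₀' ∧ x = r₀ ++ (s, m + m') :: r₀'

/-- Without merging, the integral is exactly additive. A merge affects three syllables only, namely
the merged one and its two parts, and each contributes at most `M * F`. -/
theorem syllableIntegral_join {r r' x : List (S × ℤ)} (h : IsSyllableJoin r r' x) {M F : ℝ}
    (hM0 : 0 ≤ M) (hM : ∀ s m, |lam s m| ≤ M) {f : FreeGroup S → ℝ} (hF : ∀ z, |f z| ≤ F) :
    |syllableIntegral lam x f - syllableIntegral lam r (fun z => f (z * syllableProd r'))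
      - syllableIntegral lam r' f| ≤ 3 * M * F := by
  have hF0 : 0 ≤ F := (abs_nonneg _).trans (hF 1)
  rcases h with ⟨rfl, -⟩ | ⟨r₀, s, m, m', r₀', rfl, rfl, rfl⟩
  · rw [syllableIntegral_append]
    simp only [add_sub_cancel_left, sub_self, abs_zero]
    positivity
  · have key : ∀ k a b, |lam s k / 2 * (f a + f b)| ≤ M * F := fun k a b => by
      have h1 := abs_le.1 (hF a)
      have h2 := abs_le.1 (hF b)
      have h3 : |f a + f b| ≤ 2 * F := abs_le.2 ⟨by linarith [h1.1, h2.1], by linarith [h1.2, h2.2]⟩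
      calc |lam s k / 2 * (f a + f b)| = |lam s k| * |f a + f b| / 2 := by
            rw [abs_mul, abs_div, abs_two]; ring
        _ ≤ M * (2 * F) / 2 := by
            have := mul_le_mul (hM s k) h3 (abs_nonneg _) hM0
            linarith
        _ = M * F := by ring
    simp only [syllableIntegral_append, syllableIntegral_cons, syllableIntegral_nil,
      syllableProd_cons, syllableProd_nil, mul_one, one_mul, add_zero, zpow_add, mul_assoc]
    set z := syllableProd r₀'
    have k1 := abs_le.1 (key (m + m') (FreeGroup.of s ^ m * (FreeGroup.of s ^ m' * z)) z)
    have k2 := abs_le.1 (key m (FreeGroup.of s ^ m * (FreeGroup.of s ^ m' * z))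
      (FreeGroup.of s ^ m' * z))
    have k3 := abs_le.1 (key m' (FreeGroup.of s ^ m' * z) z)
    rw [abs_le]
    constructor <;> linarith [k1.1, k1.2, k2.1, k2.2, k3.1, k3.2]

variable [DecidableEq S]

theorem syllableProd_syllables (L : List (S × Bool)) :
    syllableProd (syllables L) = FreeGroup.mk L := by
  induction L with
  | nil => rfl
  | cons a L ih =>
    obtain ⟨s, b⟩ := a
    rw [mk_cons_eq_zpow_mul, ← ih]
    rcases h : syllables L with - | ⟨⟨t, m⟩, r⟩
    · simp [syllables, h]
    · by_cases hst : s = t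
      · subst hst
        simp [syllables, h, zpow_add, mul_assoc]
      · simp [syllables, h, hst]

theorem syllables_cons_of_eq {s : S} (b : Bool) {L : List (S × Bool)} {m : ℤ} {r : List (S × ℤ)}
    (h : syllables L = (s, m) :: r) :
    syllables ((s, b) :: L) = (s, (if b then 1 else -1) + m) :: r := by
  simp [syllables, h]

theorem syllables_cons_of_ne {s t : S} (hst : s ≠ t) (b : Bool) {L : List (S × Bool)} {m : ℤ}
    {r : List (S × ℤ)} (h : syllables L = (t, m) :: r) :
    syllables ((s, b) :: L) = (s, if b then 1 else -1) :: (t, m) :: r := by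
  simp [syllables, h, hst]

theorem syllables_cons_of_nil (s : S) (b : Bool) {L : List (S × Bool)} (h : syllables L = []) :
    syllables ((s, b) :: L) = [(s, if b then 1 else -1)] := by
  simp [syllables, h]

/-- Reducedness plays no role: `syllables` adds up exponents formally, and an exponent may even
become zero. -/
theorem isSyllableJoin_syllables_append (L L' : List (S × Bool)) :
    IsSyllableJoin (syllables L) (syllables L') (syllables (L ++ L')) := by
  induction L with
  | nil => exact .inl ⟨by simp [syllables], by simp [syllables]⟩
  | cons a L ih =>
    obtain ⟨s, b⟩ := a
    rw [List.cons_append]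
    rcases ih with ⟨h, hne⟩ | ⟨r, t, m, m', r', h1, h2, h3⟩
    · rcases hL : syllables L with - | ⟨⟨t, m⟩, r⟩
      · rw [syllables_cons_of_nil s b hL]
        rw [hL, List.nil_append] at h
        rcases hL' : syllables L' with - | ⟨⟨t', m'⟩, r'⟩
        · rw [syllables_cons_of_nil s b (h.trans hL')]
          exact .inl ⟨rfl, by simp⟩
        · by_cases hst : s = t'
          · subst hst
            rw [syllables_cons_of_eq b (h.trans hL')]
            exact .inr ⟨[], s, _, m', r', rfl, rfl, rfl⟩
          · rw [syllables_cons_of_ne hst b (h.trans hL')]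
            exact .inl ⟨rfl, by simpa using Ne.symm hst⟩
      · rw [hL] at h hne
        left
        by_cases hst : s = t
        · subst hst
          rw [syllables_cons_of_eq b hL, syllables_cons_of_eq b h]
          exact ⟨rfl, hne⟩
        · rw [syllables_cons_of_ne hst b hL, syllables_cons_of_ne hst b h]
          refine ⟨rfl, ?_⟩
          rwa [List.map_cons, List.map_cons, List.getLast?_cons_cons, ← List.map_cons]
    · right
      rcases r with - | ⟨⟨u, k⟩, r⟩
      · by_cases hst : s = t
        · subst hst
          rw [syllables_cons_of_eq b h1, syllables_cons_of_eq b h3]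
          exact ⟨[], s, _, m', r', rfl, h2, by rw [add_assoc]; rfl⟩
        · rw [syllables_cons_of_ne hst b h1, syllables_cons_of_ne hst b h3]
          exact ⟨[(s, _)], t, m, m', r', rfl, h2, rfl⟩
      · by_cases hst : s = u
        · subst hst
          rw [syllables_cons_of_eq b h1, syllables_cons_of_eq b h3]
          exact ⟨(s, _) :: r, t, m, m', r', rfl, h2, rfl⟩
        · rw [syllables_cons_of_ne hst b h1, syllables_cons_of_ne hst b h3]
          exact ⟨(s, _) :: (u, k) :: r, t, m, m', r', rfl, h2, rfl⟩

/-- Inverting a word moves its first letter to the end, so the inverse word is a join with a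
one-letter syllable. It merges exactly when the generator agrees with that of the next syllable of
the original word. -/
theorem syllables_invRev (L : List (S × Bool)) :
    syllables (FreeGroup.invRev L) = syllableInv (syllables L) := by
  induction L with
  | nil => rfl
  | cons a L ih =>
    obtain ⟨s, b⟩ := a
    have hinv : FreeGroup.invRev ((s, b) :: L) = FreeGroup.invRev L ++ [(s, !b)] := by
      simp [FreeGroup.invRev]
    have hs : syllables [(s, !b)] = [(s, -(if b then 1 else -1))] := by
      cases b <;> simp [syllables]
    have hj := isSyllableJoin_syllables_append (FreeGroup.invRev L) [(s, !b)]
    rw [hinv]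
    rw [ih, hs] at hj
    rcases hL : syllables L with - | ⟨⟨t, m⟩, r⟩
    · rw [syllables_cons_of_nil s b hL]
      rcases hj with ⟨h, -⟩ | ⟨r₀, s', k, k', r₀', h, -⟩
      · rw [h, hL]
        simp [syllableInv]
      · rw [hL] at h
        simp [syllableInv] at h
    · rw [hL, syllableInv_cons] at hj
      by_cases hst : s = t
      · subst hst
        rw [syllables_cons_of_eq b hL, syllableInv_cons]
        -- The generators at the join agree, so the disjointness clause of `IsSyllableJoin` rules
        -- out the unmerged case.
        rcases hj with ⟨-, h⟩ | ⟨r₀, s', k, k', r₀', h1, h2, h3⟩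
        · simp at h
        · obtain ⟨e1, e2⟩ := List.append_inj' h1 rfl
          simp only [List.cons.injEq, Prod.mk.injEq, and_true] at e2 h2
          obtain ⟨⟨rfl, rfl⟩, rfl⟩ := h2
          rw [h3, e1, ← e2.2]
          simp only [neg_add_rev]
      · rw [syllables_cons_of_ne hst b hL, syllableInv_cons, syllableInv_cons]
        rcases hj with ⟨h, -⟩ | ⟨r₀, s', k, k', r₀', h1, h2, h3⟩
        · exact h
        · obtain ⟨e1, e2⟩ := List.append_inj' h1 rfl
          simp only [List.cons.injEq, Prod.mk.injEq, and_true] at e2 h2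
          exact absurd (h2.1.1.trans e2.1.symm) hst

theorem isExtension_rolli (hlam : ∀ s m, lam s (-m) = -lam s m) {M : ℝ}
    (hM0 : 0 ≤ M) (hM : ∀ s m, |lam s m| ≤ M) :
    IsExtension (rolli lam) (fun g => syllableIntegral lam (syllables g.toWord)) (3 * (3 * M)) := by
  have hprod : ∀ g : FreeGroup S, syllableProd (syllables g.toWord) = g := fun g => by
    rw [syllableProd_syllables, FreeGroup.mk_toWord]
  refine isExtension_of_reduced (fun g => syllableIntegral_one _) (fun g f => ?_)
    fun x y h f F hF => ?_
  · rw [FreeGroup.toWord_inv, syllables_invRev, syllableIntegral_syllableInv hlam, hprod]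
  · have hj := isSyllableJoin_syllables_append x.toWord y.toWord
    rw [← isReducedMul_iff.1 h] at hj
    have := syllableIntegral_join hj hM0 hM hF
    rwa [hprod] at this

end Rolli

/-! ### Assembling the bounds -/

section Main

variable {S : Type u}

/-- The functions are bounded one generator at a time; finiteness of the basis makes the bound
uniform. -/
theorem IsRolliParameter.rolliNorm_ne_top [Finite S] {lam : S → ℤ → ℝ}
    (hlam : IsRolliParameter lam) : rolliNorm lam ≠ ∞ := by
  cases nonempty_fintype S
  choose C hC using hlam.bounded
  refine ne_top_of_le_ne_top (ENNReal.sum_ne_top (s := Finset.univ)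
    (f := fun s => ENNReal.ofReal (C s)).2 fun s _ => ENNReal.ofReal_ne_top) ?_
  refine iSup_le fun s => iSup_le fun m => le_trans ?_
    (Finset.single_le_sum (fun _ _ => zero_le) (Finset.mem_univ s))
  rw [Real.enorm_eq_ofReal_abs]
  exact ENNReal.ofReal_le_ofReal (hC s m)

variable [DecidableEq S]

theorem kappa_one_le_sumKappa (α : FreeGroup S → ℝ) : kappa α 1 ≤ sumKappa α :=
  ENNReal.le_tsum 1

theorem IsCalegari.maxJunctureMass_ne_top {α : FreeGroup S → ℝ} (hα : IsCalegari α) :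
    maxJunctureMass α ≠ ∞ :=
  ((maxJunctureMass_le_kappa hα.toIsCoefficientMap).trans_lt hα.kappa_one_ne_top.lt_top).ne

theorem cupVanishesWithBound_brooksSum {P : Set (FreeGroup S)}
    (hP : IsPositivePart (nonSelfOverlapping S) P) {α β : FreeGroup S → ℝ} (hα : IsCalegari α)
    (hβ : IsCalegari β) : CupVanishesWithBound (brooksSum P α) (brooksSum P β)
      (27 * (maxJunctureMass α * maxJunctureMass β)) := by
  have hA := isExtension_brooksSum hP hα.toIsCoefficientMap hα.maxJunctureMass_ne_top
  have hB := isExtension_brooksSum hP hβ.toIsCoefficientMap hβ.maxJunctureMass_ne_top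
  refine hA.cupVanishesWithBound hB.isQuasimorphism hB.defect ?_
  -- A factor 3 from each of the two extensions; the 9 is then relaxed to the 27 needed for Rolli
  -- quasimorphisms.
  have h9 : 3 * (maxJunctureMass α).toReal * (3 * (maxJunctureMass β).toReal)
      = 9 * ((maxJunctureMass α).toReal * (maxJunctureMass β).toReal) := by ring
  rw [h9, ENNReal.ofReal_mul (by norm_num), ← ENNReal.toReal_mul,
    ENNReal.ofReal_toReal (ENNReal.mul_ne_top hα.maxJunctureMass_ne_top hβ.maxJunctureMass_ne_top)]
  gcongr
  norm_num

theorem cupVanishesWithBound_rolli [Finite S] {P : Set (FreeGroup S)}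
    (hP : IsPositivePart (nonSelfOverlapping S) P) {lam : S → ℤ → ℝ} {β : FreeGroup S → ℝ}
    (hlam : IsRolliParameter lam) (hβ : IsCalegari β) :
    CupVanishesWithBound (rolli lam) (brooksSum P β) (27 * (rolliNorm lam * maxJunctureMass β)) := by
  have hM : ∀ s m, |lam s m| ≤ (rolliNorm lam).toReal := fun s m => by
    have : ‖lam s m‖ₑ ≤ rolliNorm lam := le_iSup_of_le s (le_iSup_of_le m le_rfl)
    have := ENNReal.toReal_mono hlam.rolliNorm_ne_top this
    rwa [toReal_enorm, Real.norm_eq_abs] at this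
  have hA := isExtension_rolli hlam.alternating ENNReal.toReal_nonneg hM
  have hB := isExtension_brooksSum hP hβ.toIsCoefficientMap hβ.maxJunctureMass_ne_top
  refine hA.cupVanishesWithBound hB.isQuasimorphism hB.defect ?_
  -- Three reduced products times three affected syllables for `lam`, and three reduced products for
  -- `β`.
  have h27 : 3 * (3 * (rolliNorm lam).toReal) * (3 * (maxJunctureMass β).toReal)
      = 27 * ((rolliNorm lam).toReal * (maxJunctureMass β).toReal) := by ring
  rw [h27, ENNReal.ofReal_mul (by norm_num), ← ENNReal.toReal_mul,
    ENNReal.ofReal_toReal (ENNReal.mul_ne_top hlam.rolliNorm_ne_top hβ.maxJunctureMass_ne_top)]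
  gcongr
  norm_num

end Main

theorem theorem4 :
    ∃ K : ℝ≥0, ∀ (S : Type u) [DecidableEq S] [Finite S] [Nontrivial S]
      (P : Set (FreeGroup S)), IsPositivePart (nonSelfOverlapping S) P →
      ∀ (α β : FreeGroup S → ℝ) (lam : S → ℤ → ℝ),
        IsCalegari α → IsCalegari β → IsRolliParameter lam →
        (∀ I : Set (FreeGroup S), IsSymmetricFamily I → IsIndependent I →
          Function.support α ⊆ I → Function.support β ⊆ I →
          CupVanishesWithBound (brooksSum P α) (brooksSum P β) (K * (supNorm α * supNorm β))) ∧
        (IsL1Ind α → IsKappaL1 β →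
          CupVanishesWithBound (brooksSum P α) (brooksSum P β) (K * (sInd α * sumKappa β))) ∧
        (IsKappaL1 β →
          CupVanishesWithBound (rolli lam) (brooksSum P β) (K * (rolliNorm lam * sumKappa β))) ∧
        (IsL1Ind α → IsKappaC0 β →
          CupSeminormVanishes (brooksSum P α) (brooksSum P β)) ∧
        (IsKappaC0 β →
          CupSeminormVanishes (rolli lam) (brooksSum P β)) := by
  refine ⟨27, fun S _ _ _ P hP α β lam hα hβ hlam => ?_⟩
  have hB := cupVanishesWithBound_brooksSum hP hα hβ
  have hR := cupVanishesWithBound_rolli hP hlam hβ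
  have hκ : maxJunctureMass β ≤ sumKappa β :=
    (maxJunctureMass_le_kappa hβ.toIsCoefficientMap).trans (kappa_one_le_sumKappa β)
  refine ⟨fun I _ hI hαI hβI => hB.mono ?_, fun _ _ => hB.mono ?_, fun _ => hR.mono ?_,
    fun _ _ => hB.cupSeminormVanishes, fun _ => hR.cupSeminormVanishes⟩
  · exact mul_le_mul_right
      (mul_le_mul' (maxJunctureMass_le_supNorm hI hαI) (maxJunctureMass_le_supNorm hI hβI)) _
  · exact mul_le_mul_right (mul_le_mul' (maxJunctureMass_le_sInd α) hκ) _
  · exact mul_le_mul_right (mul_le_mul_right hκ _) _
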